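/- Let $P$ be a smooth finite-dimensional manifold and let $h:\mathbb{R}^\times\times P\to P$ be an action making $P$ an $\mathbb{R}^\times$-principal bundle over a smooth manifold $M$ (Hausdorff, second countable), where $\mathbb{R}^\times=\mathbb{R}\setminus\{0\}$: the action is smooth, and there is a smooth surjection $P\to M$ with smooth $\mathbb{R}^\times$-equivariant local trivializations $U\times\mathbb{R}^\times$. For such an action let $(\mathrm{d}_T h)_s=T h_s$ be the tangent lift to $TP$ and $(\mathrm{d}_{T}^* h)_s(\alpha)=s\cdot (T h_{s^{-1}})^*\alpha$ the phase lift to $T^*P$. Let $\omega_P=\mathrm{d}\theta_P$ be the canonical symplectic form on $T^*P$, with $\theta_P=p_i\,\mathrm{d}x^i$ the Liouville form, let $\beta_P:TT^*P\to T^*T^*P$, $\beta_P(v)=\omega_P(\cdot,v)$, and let $\alpha_P:TT^*P\to T^*TP$ be the Tulczyjew isomorphism, dual to the canonical flip $\kappa_P:TTP\to TTP$; in adapted coordinates $\beta_P(x,p,\dot x,\dot p)=(x,p,-\dot p,\dot x)$ and $\alpha_P(x,p,\dot x,\dot p)=(x,\dot x,\dot p,p)$. Then $TP$ and $T^*P$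 with the actions $\mathrm{d}_T h$ and $\mathrm{d}_T^* h$, and $TT^*P$, $T^*T^*P$, $T^*TP$ with the actions $\mathrm{d}_T\mathrm{d}_T^* h$, $\mathrm{d}_T^*\mathrm{d}_T^* h$, $\mathrm{d}_T^*\mathrm{d}_T h$, are $\mathbb{R}^\times$-principal bundles over smooth manifolds, and, for these structures, all the maps of the classical Tulczyjew triple of $P$ are surjective morphisms of $\mathbb{R}^\times$-principal bundles (smooth equivariant maps covering smooth maps of the base manifolds), namely - $\beta_P:TT^*P\to T^*T^*P$ and $\alpha_P:TT^*P\to T^*TP$, which are moreover isomorphisms of $\mathbb{R}^\times$-principal bundles; - the cotangent bundle projection $T^*T^*P\to T^*P$ and the projection $T^*T^*P\to (T^*P)^*=TP$ given by restricting covectors to the vectors tangent to the fibres of $T^*P$; - the tangent bundle projection $TT^*P\to T^*P$ and $T\pi_P:TT^*P\to TP$; - the cotangent bundle projection $T^*TP\to TP$ and the projection $T^*TP\to T^*P$ given by restricting covectors to the vectors tangent to the fibres of $TP$; - the projections $\tau_P:TP\to P$ and $\pi_P:T^*P\to P$; - the remaining horizontal arrows, which are the identity maps of $TP$, $T^*P$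 and $P$. -/

import Mathlib

open scoped Manifold ContDiff
open Bundle

noncomputable section

namespace Tulczyjew

universe uE uH uP uE' uH' uP'

section Basic

variable {E : Type uE} [NormedAddCommGroup E] [NormedSpace ℝ E]
  {H : Type uH} [TopologicalSpace H] (I : ModelWithCorners ℝ E H)

section PrincipalBundles

variable {P : Type uP} [TopologicalSpace P] [ChartedSpace H P]

/-- The structure of an `ℝˣ`-principal bundle on the smooth manifold `P` endowed with the
action `h s : P → P`, `s ∈ ℝˣ`, of the multiplicative group `ℝˣ = ℝ \ {0}`: a smooth
finite-dimensional (Hausdorff, second countable) base manifold `Base`, a smooth surjection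
`proj : P → Base`, and smooth `ℝˣ`-equivariant local trivializations
`proj⁻¹(U) ≃ U × ℝˣ` around every point of the base. -/
structure RtPrincipalBundle (h : ℝˣ → P → P) where
  /-- The base manifold. -/
  Base : Type (max uP uE)
  /-- The dimension of the base manifold. -/
  dimBase : ℕ
  [topBase : TopologicalSpace Base]
  [t2Base : T2Space Base]
  [secondCountableBase : SecondCountableTopology Base]
  [chartedBase : ChartedSpace (EuclideanSpace ℝ (Fin dimBase)) Base]
  [isManifoldBase : IsManifold (𝓡 dimBase) ∞ Base]
  /-- The bundle projection. -/
  proj : P → Base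
  act_one : ∀ p, h 1 p = p
  act_mul : ∀ s t p, h (s * t) p = h s (h t p)
  contMDiff_act : ContMDiff (𝓘(ℝ, ℝ).prod I) I ∞ (fun z : ℝˣ × P => h z.1 z.2)
  contMDiff_proj : ContMDiff I (𝓡 dimBase) ∞ proj
  surjective_proj : Function.Surjective proj
  proj_act : ∀ s p, proj (h s p) = proj p
  exists_trivialization : ∀ x : Base, ∃ e : Trivialization ℝˣ proj,
    x ∈ e.baseSet ∧
    ContMDiffOn I ((𝓡 dimBase).prod 𝓘(ℝ, ℝ)) ∞ e e.source ∧
    ContMDiffOn ((𝓡 dimBase).prod 𝓘(ℝ, ℝ)) I ∞ e.toOpenPartialHomeomorph.symm e.target ∧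
    ∀ s : ℝˣ, ∀ p ∈ e.source, (e (h s p)).2 = s * (e p).2

attribute [instance] RtPrincipalBundle.topBase RtPrincipalBundle.t2Base
  RtPrincipalBundle.secondCountableBase RtPrincipalBundle.chartedBase
  RtPrincipalBundle.isManifoldBase

variable {I}
variable {E' : Type uE'} [NormedAddCommGroup E'] [NormedSpace ℝ E']
  {H' : Type uH'} [TopologicalSpace H'] {I' : ModelWithCorners ℝ E' H'}
  {P' : Type uP'} [TopologicalSpace P'] [ChartedSpace H' P']
  {h : ℝˣ → P → P} {h' : ℝˣ → P' → P'}

/-- A morphism of `ℝˣ`-principal bundles: a smooth equivariant map of the total spaces which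
covers a smooth map of the bases. -/
structure IsPrincipalMorphism (B : RtPrincipalBundle I h) (B' : RtPrincipalBundle I' h')
    (Φ : P → P') : Prop where
  contMDiff : ContMDiff I I' ∞ Φ
  equivariant : ∀ s p, Φ (h s p) = h' s (Φ p)
  covers : ∃ φ : B.Base → B'.Base, ContMDiff (𝓡 B.dimBase) (𝓡 B'.dimBase) ∞ φ ∧
    ∀ p, B'.proj (Φ p) = φ (B.proj p)

/-- A morphism of `ℝˣ`-principal bundles which is surjective (as a map of total spaces). -/
def IsSurjectivePrincipalMorphism (B : RtPrincipalBundle I h) (B' : RtPrincipalBundle I' h')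
    (Φ : P → P') : Prop :=
  IsPrincipalMorphism B B' Φ ∧ Function.Surjective Φ

/-- An isomorphism of `ℝˣ`-principal bundles: a morphism with a two-sided inverse morphism. -/
def IsPrincipalIsomorphism (B : RtPrincipalBundle I h) (B' : RtPrincipalBundle I' h')
    (Φ : P → P') : Prop :=
  IsPrincipalMorphism B B' Φ ∧ ∃ Ψ : P' → P, IsPrincipalMorphism B' B Ψ ∧
    Function.LeftInverse Ψ Φ ∧ Function.RightInverse Ψ Φ

end PrincipalBundles

section TangentCotangent

variable (P : Type uP) [TopologicalSpace P] [ChartedSpace H P] [IsManifold I ∞ P]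

/-- The cotangent bundle `T*P`: the bundle of continuous linear maps from the tangent bundle to
the trivial line bundle, with Mathlib's smooth vector bundle structure. -/
abbrev CotangentBundle : Type (max uP uE) :=
  TotalSpace (E →L[ℝ] ℝ) (fun p : P => TangentSpace I p →L[ℝ] Bundle.Trivial P ℝ p)

/-- The model with corners of the cotangent bundle. -/
abbrev cotangentModel : ModelWithCorners ℝ (E × (E →L[ℝ] ℝ)) (ModelProd H (E →L[ℝ] ℝ)) :=
  I.prod 𝓘(ℝ, E →L[ℝ] ℝ)

variable {P}

/-- The projection `τ_P : TP → P`. -/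
def tangentProj (v : TangentBundle I P) : P := v.proj

/-- The projection `π_P : T*P → P`. -/
def cotangentProj (α : CotangentBundle I P) : P := α.proj

/-- The tangent lift `(d_T h)_s = T h_s : TP → TP` of an action. -/
def tangentLift (h : ℝˣ → P → P) (s : ℝˣ) : TangentBundle I P → TangentBundle I P :=
  tangentMap I I (h s)

/-- The phase lift `(d_T^* h)_s (α) = s ⬝ (T h_{s⁻¹})^* α` of an action to the cotangent bundle.
The covector at `h s p` obtained from `α ∈ T*_p P` is
`s ⬝ α ∘ (T h_{s⁻¹} : T_{h s p} P → T_p P)`. -/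
def phaseLift (h : ℝˣ → P → P) (s : ℝˣ) (α : CotangentBundle I P) : CotangentBundle I P :=
  ⟨h s α.proj,
    (s : ℝ) • ((show E →L[ℝ] ℝ from α.2) ∘L
      (show E →L[ℝ] E from mfderiv I I (h s⁻¹) (h s α.proj)))⟩

/-- The exterior derivative `dθ` at `x` of a one-form `θ` on a manifold,
`dθ(v, w) = D_v (θ(w)) - D_w (θ(v))`, computed in the preferred chart at `x` (through which Mathlib
identifies the tangent space at `x` with the model vector space `E`). -/
def extDerivOneForm (θ : ∀ x : P, TangentSpace I x →L[ℝ] ℝ) (x : P) :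
    TangentSpace I x →L[ℝ] TangentSpace I x →L[ℝ] ℝ :=
  let η : E → (E →L[ℝ] ℝ) := fun y =>
    (show E →L[ℝ] ℝ from θ ((extChartAt I x).symm y)) ∘L
      (show E →L[ℝ] E from
        mfderivWithin 𝓘(ℝ, E) I (extChartAt I x).symm (Set.range I) y)
  let D : E →L[ℝ] E →L[ℝ] ℝ := fderivWithin ℝ η (Set.range I) (extChartAt I x x)
  (show E →L[ℝ] E →L[ℝ] ℝ from D - D.flip)

/-- The Liouville one-form `θ_P` on `T*P`, `θ_P(α)(v) = α(T π_P (v))`; in coordinates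
`θ_P = p_i dx^i`. -/
def liouvilleForm (α : CotangentBundle I P) :
    TangentSpace (cotangentModel I) α →L[ℝ] ℝ :=
  (show TangentSpace I α.proj →L[ℝ] ℝ from α.2) ∘L
    mfderiv (cotangentModel I) I (cotangentProj I) α

/-- The canonical symplectic form `ω_P = dθ_P` on `T*P`; in coordinates
`ω_P = dp_i ∧ dx^i`. -/
def symplecticForm (α : CotangentBundle I P) :
    TangentSpace (cotangentModel I) α →L[ℝ] TangentSpace (cotangentModel I) α →L[ℝ] ℝ :=
  extDerivOneForm (cotangentModel I) (P := CotangentBundle I P) (liouvilleForm I) α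

/-- The map `β_P : TT*P → T*T*P`, `β_P(v) = ω_P(·, v)`. -/
def betaMap (v : TangentBundle (cotangentModel I) (CotangentBundle I P)) :
    CotangentBundle (cotangentModel I) (CotangentBundle I P) :=
  ⟨v.proj, (show (E × (E →L[ℝ] ℝ)) →L[ℝ] (E × (E →L[ℝ] ℝ)) →L[ℝ] ℝ from
    symplecticForm I v.proj).flip v.2⟩

/-- The canonical flip `κ_P : TTP → TTP`, in coordinates `(x, ẋ, x', ẋ') ↦ (x, x', ẋ, ẋ')`.
An element of `TTP` is written in Mathlib as `⟨⟨p, ẋ⟩, (x', ẋ')⟩`, where `ẋ`, `x'` and `ẋ'` are its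
components in the preferred chart at `p` and in the chart of `TP` induced by it. -/
def canonicalFlip (w : TangentBundle I.tangent (TangentBundle I P)) :
    TangentBundle I.tangent (TangentBundle I P) :=
  ⟨⟨w.proj.proj, (show E × E from w.2).1⟩,
    (show E × E from ((show E from w.proj.2), (show E × E from w.2).2))⟩

/-- The tangent lift of the pairing `T*P ×_P TP → ℝ`, `(x, p, y) ↦ p(y)`; in the charts induced by
the preferred chart of `P` at the base point, it is `(x, p, ẋ, ṗ), (x, y, ẋ, ẏ) ↦ ṗ(y) + p(ẏ)`.
It is meaningful for `v ∈ TT*P` and `w ∈ TTP` with `T π_P (v) = T τ_P (w)`. -/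
def tangentPairing (v : TangentBundle (cotangentModel I) (CotangentBundle I P))
    (w : TangentBundle I.tangent (TangentBundle I P)) : ℝ :=
  (show E × (E →L[ℝ] ℝ) from v.2).2 (show E from w.proj.2) +
    (show E →L[ℝ] ℝ from v.proj.2) (show E × E from w.2).2

/-- The map `T π_P : TT*P → TP`. -/
def tangentOfCotangentProj (v : TangentBundle (cotangentModel I) (CotangentBundle I P)) :
    TangentBundle I P :=
  tangentMap (cotangentModel I) I (cotangentProj I) v

section FiniteDim

variable [FiniteDimensional ℝ E]

/-- The Tulczyjew isomorphism `α_P : TT*P → T*TP`, the dual of the canonical flip: the covector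
`α_P(v)` at `u = T π_P (v) ∈ TP` is given by `⟨α_P(v), w⟩ = ⟨v, κ_P(w)⟩` for `w ∈ T_u TP`, where the
pairing on the right is the tangent lift of the pairing between `T*P` and `TP`. -/
def alphaMap (v : TangentBundle (cotangentModel I) (CotangentBundle I P)) :
    CotangentBundle I.tangent (TangentBundle I P) :=
  ⟨tangentOfCotangentProj I v,
    (show (E × E) →L[ℝ] ℝ from LinearMap.toContinuousLinearMap (E := E × E) (F' := ℝ)
      { toFun := fun (w : E × E) => tangentPairing I v (canonicalFlip I ⟨tangentOfCotangentProj I v, w⟩)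
        map_add' := fun w w' => by
          change (show E × (E →L[ℝ] ℝ) from v.2).2 (w.1 + w'.1) +
              (show E →L[ℝ] ℝ from v.proj.2) (w.2 + w'.2) =
            ((show E × (E →L[ℝ] ℝ) from v.2).2 w.1 + (show E →L[ℝ] ℝ from v.proj.2) w.2) +
            ((show E × (E →L[ℝ] ℝ) from v.2).2 w'.1 + (show E →L[ℝ] ℝ from v.proj.2) w'.2)
          rw [map_add, map_add]; ring
        map_smul' := fun c w => by
          change (show E × (E →L[ℝ] ℝ) from v.2).2 (c • w.1) +
              (show E →L[ℝ] ℝ from v.proj.2) (c • w.2) =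
            c • ((show E × (E →L[ℝ] ℝ) from v.2).2 w.1 + (show E →L[ℝ] ℝ from v.proj.2) w.2)
          rw [map_smul, map_smul, smul_add] })⟩

/-- The projection `T*T*P → (T*P)* = TP` of the double vector bundle `T*T*P`: a covector `φ` at
`α ∈ T*_p P` is restricted to the vertical vectors at `α`, i.e. composed with the derivative at `α`
of the inclusion of the fibre `T*_p P`, and the resulting element of `(T*_p P)*` is regarded as a
vector in `T_p P`. -/
def cotangentCotangentToTangent
    (φ : CotangentBundle (cotangentModel I) (CotangentBundle I P)) : TangentBundle I P :=
  let vert : (E →L[ℝ] ℝ) →L[ℝ] (E × (E →L[ℝ] ℝ)) :=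
    mfderiv 𝓘(ℝ, E →L[ℝ] ℝ) (cotangentModel I)
      (fun b : E →L[ℝ] ℝ => (⟨φ.proj.proj, b⟩ : CotangentBundle I P)) φ.proj.2
  ⟨φ.proj.proj, (show E from (Module.evalEquiv ℝ E).symm
    (((show (E × (E →L[ℝ] ℝ)) →L[ℝ] ℝ from φ.2) ∘L vert).toLinearMap ∘ₗ
      (LinearMap.toContinuousLinearMap (E := E) (F' := ℝ)).toLinearMap))⟩

end FiniteDim

/-- The projection `T*TP → T*P` of the double vector bundle `T*TP`: a covector `φ` at `v ∈ T_p P` is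
restricted to the vertical vectors at `v`, i.e. composed with the derivative at `v` of the inclusion
of the fibre `T_p P`. -/
def cotangentTangentToCotangent (φ : CotangentBundle I.tangent (TangentBundle I P)) :
    CotangentBundle I P :=
  let vert : E →L[ℝ] (E × E) :=
    mfderiv 𝓘(ℝ, E) I.tangent
      (fun b : E => (⟨φ.proj.proj, b⟩ : TangentBundle I P)) φ.proj.2
  ⟨φ.proj.proj, (show (E × E) →L[ℝ] ℝ from φ.2) ∘L vert⟩

end TangentCotangent

end Basic

end Tulczyjew

end

noncomputable section

namespace Tulczyjew

open Set Filter Topology Module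

section AdaptedCharts

variable {E : Type*} [NormedAddCommGroup E] [NormedSpace ℝ E] [FiniteDimensional ℝ E]

/-- A nonzero linear functional is a coordinate of a linear system of coordinates. -/
theorem exists_continuousLinearEquiv_prod_snd_eq (ℓ : E →L[ℝ] ℝ) (hℓ : ℓ ≠ 0) :
    ∃ A : E ≃L[ℝ] EuclideanSpace ℝ (Fin (finrank ℝ E - 1)) × ℝ, ∀ x, (A x).2 = ℓ x := by
  have hsurj : LinearMap.range (ℓ : E →ₗ[ℝ] ℝ) = ⊤ := by
    apply LinearMap.range_eq_top.2
    exact LinearMap.surjective (fun h0 => hℓ (ContinuousLinearMap.coe_injective h0))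
  have hrank : finrank ℝ (LinearMap.ker (ℓ : E →ₗ[ℝ] ℝ)) = finrank ℝ E - 1 := by
    have := LinearMap.finrank_range_add_finrank_ker (ℓ : E →ₗ[ℝ] ℝ)
    rw [hsurj, finrank_top, finrank_self] at this
    omega
  obtain ⟨v, hv⟩ : ∃ v, ℓ v = 1 := LinearMap.range_eq_top.1 hsurj 1
  let L : LinearMap.ker (ℓ : E →ₗ[ℝ] ℝ) ≃L[ℝ] EuclideanSpace ℝ (Fin (finrank ℝ E - 1)) :=
    ContinuousLinearEquiv.ofFinrankEq (by rw [hrank, finrank_euclideanSpace_fin])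
  let A₀ : E ≃ₗ[ℝ] LinearMap.ker (ℓ : E →ₗ[ℝ] ℝ) × ℝ :=
    { toFun := fun x => (⟨x - ℓ x • v, by simp [hv]⟩, ℓ x)
      invFun := fun z => z.1 + z.2 • v
      map_add' := fun x y => by
        ext <;> simp [add_smul]; abel
      map_smul' := fun c x => by
        ext <;> simp [mul_smul, smul_sub]
      left_inv := fun x => by simp
      right_inv := fun z => by
        have hz : ℓ (z.1 : E) = 0 := z.1.2
        ext <;> simp [hv, hz] }
  exact ⟨A₀.toContinuousLinearEquiv.trans (L.prodCongr (ContinuousLinearEquiv.refl ℝ ℝ)),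
    fun x => rfl⟩

/-- A function with nonzero derivative is the last coordinate of a smooth local chart. -/
theorem exists_openPartialHomeomorph_snd_eq {O : Set E} (hO : IsOpen O) {g : E → ℝ}
    (hg : ContDiffOn ℝ ∞ g O) {x : E} (hx : x ∈ O) (hgx : fderiv ℝ g x ≠ 0) :
    ∃ ψ : OpenPartialHomeomorph E (EuclideanSpace ℝ (Fin (finrank ℝ E - 1)) × ℝ),
      x ∈ ψ.source ∧ ψ.source ⊆ O ∧ ContDiffOn ℝ ∞ ψ ψ.source ∧
      ContDiffOn ℝ ∞ ψ.symm ψ.target ∧ ∀ y, (ψ y).2 = g y := by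
  obtain ⟨A, hA⟩ := exists_continuousLinearEquiv_prod_snd_eq _ hgx
  let L : E →L[ℝ] EuclideanSpace ℝ (Fin (finrank ℝ E - 1)) :=
    (ContinuousLinearMap.fst ℝ _ ℝ) ∘L
      (A : E →L[ℝ] EuclideanSpace ℝ (Fin (finrank ℝ E - 1)) × ℝ)
  let G : E → EuclideanSpace ℝ (Fin (finrank ℝ E - 1)) × ℝ := fun y => (L y, g y)
  have hG : ContDiffOn ℝ ∞ G O := L.contDiff.contDiffOn.prodMk hg
  have hgd : ∀ y ∈ O, HasFDerivAt g (fderiv ℝ g y) y := fun y hy =>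
    ((hg.contDiffAt (hO.mem_nhds hy)).differentiableAt (by simp)).hasFDerivAt
  have hGd : ∀ y ∈ O, HasFDerivAt G (L.prod (fderiv ℝ g y)) y := fun y hy =>
    L.hasFDerivAt.prodMk (hgd y hy)
  have hAx : (A : E →L[ℝ] EuclideanSpace ℝ (Fin (finrank ℝ E - 1)) × ℝ) = L.prod (fderiv ℝ g x) := by
    ext1 y
    exact Prod.ext rfl (hA y)
  have hstrict : HasStrictFDerivAt G (A : E →L[ℝ] _) x :=
    (hG.contDiffAt (hO.mem_nhds hx)).hasStrictFDerivAt' (hAx ▸ hGd x hx) (by simp)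
  let N : Set E := O ∩ fderiv ℝ G ⁻¹'
    range ((↑) : (E ≃L[ℝ] EuclideanSpace ℝ (Fin (finrank ℝ E - 1)) × ℝ) → E →L[ℝ] _)
  have hN : IsOpen N := (hG.continuousOn_fderiv_of_isOpen hO (by simp)).isOpen_inter_preimage hO
    ContinuousLinearEquiv.isOpen
  have hxN : x ∈ N := ⟨hx, A, by rw [hAx, (hGd x hx).fderiv]⟩
  let ψ := (hstrict.toOpenPartialHomeomorph G).restrOpen N hN
  have hψ : ∀ y, ψ y = G y := fun y => rfl
  have hsrc : ψ.source ⊆ N := inter_subset_right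
  refine ⟨ψ, ⟨hstrict.mem_toOpenPartialHomeomorph_source, hxN⟩, fun y hy => (hsrc hy).1,
    hG.mono fun y hy => (hsrc hy).1, fun z hz => ?_, fun y => rfl⟩
  have hz' := hsrc (ψ.map_target hz)
  obtain ⟨B, hB⟩ := hz'.2
  refine (ψ.contDiffAt_symm (f₀' := B) hz ?_ ?_).contDiffWithinAt
  · rw [hB, (hGd _ hz'.1).fderiv]; exact hGd _ hz'.1
  · exact hG.contDiffAt (hO.mem_nhds hz'.1)

variable {H : Type*} [TopologicalSpace H] {I : ModelWithCorners ℝ E H} [I.Boundaryless]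
  {Q : Type*} [TopologicalSpace Q] [ChartedSpace H Q] [IsManifold I ∞ Q]

theorem exists_chart_snd_eq {W : Set Q} (hW : IsOpen W) {g : Q → ℝ}
    (hg : ContMDiffOn I 𝓘(ℝ, ℝ) ∞ g W) {q : Q} (hq : q ∈ W) (hgq : mfderiv I 𝓘(ℝ, ℝ) g q ≠ 0) :
    ∃ ψ : OpenPartialHomeomorph Q (EuclideanSpace ℝ (Fin (finrank ℝ E - 1)) × ℝ),
      q ∈ ψ.source ∧ ψ.source ⊆ W ∧
      ContMDiffOn I 𝓘(ℝ, EuclideanSpace ℝ (Fin (finrank ℝ E - 1)) × ℝ) ∞ ψ ψ.source ∧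
      ContMDiffOn 𝓘(ℝ, EuclideanSpace ℝ (Fin (finrank ℝ E - 1)) × ℝ) I ∞ ψ.symm ψ.target ∧
      ∀ y ∈ ψ.source, (ψ y).2 = g y := by
  let φ : OpenPartialHomeomorph Q E :=
    (chartAt H q).trans I.toHomeomorph.toOpenPartialHomeomorph
  have hφsrc : φ.source = (chartAt H q).source := by simp [φ]
  have hφ : (φ : Q → E) = extChartAt I q := rfl
  have hφs : (φ.symm : E → Q) = (extChartAt I q).symm := rfl
  have hφt : φ.target = (extChartAt I q).target := by
    simp [φ, ModelWithCorners.toHomeomorph, I.range_eq_univ]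
  have hφsm : ContMDiffOn I 𝓘(ℝ, E) ∞ φ φ.source := by
    rw [hφ, hφsrc]; exact contMDiffOn_extChartAt
  have hφssm : ContMDiffOn 𝓘(ℝ, E) I ∞ φ.symm φ.target := by
    rw [hφs, hφt]; exact contMDiffOn_extChartAt_symm q
  let O := φ.target ∩ φ.symm ⁻¹' W
  have hO : IsOpen O := φ.isOpen_inter_preimage_symm hW
  have hgO : ContDiffOn ℝ ∞ (g ∘ φ.symm) O :=
    (hg.comp (hφssm.mono inter_subset_left) (fun y hy => hy.2)).contDiffOn
  have hqφ : q ∈ φ.source := by rw [hφsrc]; exact mem_chart_source H q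
  have hd : fderiv ℝ (g ∘ φ.symm) (φ q) ≠ 0 := by
    have hmd : MDifferentiableAt I 𝓘(ℝ, ℝ) g q :=
      (hg.contMDiffAt (hW.mem_nhds hq)).mdifferentiableAt (by simp)
    intro h0
    apply hgq
    rw [hmd.mfderiv, I.range_eq_univ, fderivWithin_univ]
    exact h0
  obtain ⟨ψ, h1, h2, h3, h4, h5⟩ := exists_openPartialHomeomorph_snd_eq hO hgO
    (x := φ q) ⟨φ.map_source hqφ, by rw [mem_preimage, φ.left_inv hqφ]; exact hq⟩ hd
  have hsrc : ∀ y ∈ (φ.trans ψ).source, y ∈ φ.source ∧ φ y ∈ ψ.source := fun y hy => by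
    simpa using hy
  have htgt : ∀ y ∈ (φ.trans ψ).target, y ∈ ψ.target ∧ ψ.symm y ∈ φ.target := fun y hy => by
    simpa using hy
  refine ⟨φ.trans ψ, by simp [hqφ, h1], fun y hy => ?_, ?_, ?_, fun y hy => ?_⟩
  · obtain ⟨hy1, hy2⟩ := hsrc y hy
    have := (h2 hy2).2
    rwa [mem_preimage, φ.left_inv hy1] at this
  · exact h3.contMDiffOn.comp (hφsm.mono fun y hy => (hsrc y hy).1) (fun y hy => (hsrc y hy).2)
  · exact hφssm.comp (h4.contMDiffOn.mono fun y hy => (htgt y hy).1) (fun y hy => (htgt y hy).2)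
  · change (ψ (φ y)).2 = g y
    rw [h5]
    exact congrArg g (φ.left_inv (hsrc y hy).1)

end AdaptedCharts

section FlowBoxes

variable {E : Type*} [NormedAddCommGroup E] [NormedSpace ℝ E]
  {H : Type*} [TopologicalSpace H] (I : ModelWithCorners ℝ E H)
  {Q : Type*} [TopologicalSpace Q] [ChartedSpace H Q]

/-- A smooth action of the Lie group `ℝˣ` on a manifold. -/
structure IsSmoothAction (h : ℝˣ → Q → Q) : Prop where
  act_one : ∀ q, h 1 q = q
  act_mul : ∀ s t q, h (s * t) q = h s (h t q)
  contMDiff : ContMDiff (𝓘(ℝ, ℝ).prod I) I ∞ (fun z : ℝˣ × Q => h z.1 z.2)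

/-- A chart of an `ℝˣ`-manifold with values in `ℝᵈ × ℝˣ`, defined on an invariant open set, in which
the action is multiplication on the second factor. -/
structure FlowBox (h : ℝˣ → Q → Q) (d : ℕ) where
  /-- The underlying chart. -/
  chart : OpenPartialHomeomorph Q (EuclideanSpace ℝ (Fin d) × ℝˣ)
  act_mem : ∀ s, ∀ q ∈ chart.source, h s q ∈ chart.source
  chart_act : ∀ s, ∀ q ∈ chart.source, chart (h s q) = ((chart q).1, s * (chart q).2)
  contMDiffOn_chart : ContMDiffOn I ((𝓡 d).prod 𝓘(ℝ, ℝ)) ∞ chart chart.source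
  contMDiffOn_symm : ContMDiffOn ((𝓡 d).prod 𝓘(ℝ, ℝ)) I ∞ chart.symm chart.target

variable {I} {h : ℝˣ → Q → Q}

namespace IsSmoothAction

variable (hh : IsSmoothAction I h)
include hh

theorem act_inv_act (s : ℝˣ) (q : Q) : h s⁻¹ (h s q) = q := by
  rw [← hh.act_mul, inv_mul_cancel, hh.act_one]

theorem act_act_inv (s : ℝˣ) (q : Q) : h s (h s⁻¹ q) = q := by
  rw [← hh.act_mul, mul_inv_cancel, hh.act_one]

theorem contMDiff_act (s : ℝˣ) : ContMDiff I I ∞ (h s) :=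
  hh.contMDiff.comp (contMDiff_const.prodMk contMDiff_id)

theorem contMDiff_orbit (q : Q) : ContMDiff 𝓘(ℝ, ℝ) I ∞ (fun s => h s q) :=
  hh.contMDiff.comp (contMDiff_id.prodMk contMDiff_const)

end IsSmoothAction

/-- An equivariant `ℝˣ`-valued function has nonzero derivative where it takes the value `1`. -/
theorem mfderiv_ne_zero_of_equivariant (hh : IsSmoothAction I h) {W : Set Q} (hW : IsOpen W)
    {f : Q → ℝˣ} (hf : ContMDiffOn I 𝓘(ℝ, ℝ) ∞ f W) (hfh : ∀ s, ∀ q ∈ W, f (h s q) = s * f q)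
    {q : Q} (hq : q ∈ W) (hfq : f q = 1) :
    mfderiv I 𝓘(ℝ, ℝ) (fun q => (f q : ℝ)) q ≠ 0 := by
  intro h0
  have hg : MDifferentiableAt I 𝓘(ℝ, ℝ) (fun q => (f q : ℝ)) (h 1 q) := by
    rw [hh.act_one]
    exact ((Units.contMDiff_val (n := ∞)).contMDiffAt.comp q
      (hf.contMDiffAt (hW.mem_nhds hq))).mdifferentiableAt (by simp)
  have ho : MDifferentiableAt 𝓘(ℝ, ℝ) I (fun s => h s q) 1 :=
    (hh.contMDiff_orbit q).mdifferentiableAt (by simp)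
  have hcomp : (fun q => (f q : ℝ)) ∘ (fun s => h s q) = extChartAt 𝓘(ℝ, ℝ) (1 : ℝˣ) := by
    ext s
    change ((f (h s q) : ℝˣ) : ℝ) = (s : ℝ)
    rw [hfh s q hq, hfq, mul_one]
  have h1 := mfderiv_comp (1 : ℝˣ) hg ho
  have h2 : mfderiv I 𝓘(ℝ, ℝ) (fun q => (f q : ℝ)) (h 1 q) = 0 := by
    rw [hh.act_one]; exact h0
  rw [hcomp, h2, ContinuousLinearMap.zero_comp] at h1
  obtain ⟨A, hA⟩ := isInvertible_mfderiv_extChartAt (I := 𝓘(ℝ, ℝ))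
    (mem_extChartAt_source (I := 𝓘(ℝ, ℝ)) (1 : ℝˣ))
  rw [h1] at hA
  have h3 : A (1 : ℝ) = 0 := DFunLike.congr_fun hA (1 : ℝ)
  exact one_ne_zero (α := ℝ) (A.map_eq_zero_iff.1 h3)

theorem exists_flowBox [FiniteDimensional ℝ E] [I.Boundaryless] [IsManifold I ∞ Q]
    (hh : IsSmoothAction I h) {W : Set Q} (hW : IsOpen W) (hWh : ∀ s, ∀ q ∈ W, h s q ∈ W)
    {f : Q → ℝˣ} (hf : ContMDiffOn I 𝓘(ℝ, ℝ) ∞ f W) (hfh : ∀ s, ∀ q ∈ W, f (h s q) = s * f q)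
    {q₀ : Q} (hq₀ : q₀ ∈ W) :
    ∃ T : FlowBox I h (finrank ℝ E - 1), q₀ ∈ T.chart.source := by
  let r : Q → Q := fun q => h (f q)⁻¹ q
  have hrW : ∀ q ∈ W, r q ∈ W := fun q hq => hWh _ q hq
  have hr1 : ∀ q ∈ W, f (r q) = 1 := fun q hq => by
    simp only [r]; rw [hfh _ q hq, inv_mul_cancel]
  have hr : ContMDiffOn I I ∞ r W :=
    hh.contMDiff.comp_contMDiffOn (hf.inv.prodMk contMDiffOn_id)
  have hrinv : ∀ q, h (f q) (r q) = q := fun q => hh.act_act_inv _ _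
  have hrh : ∀ s, ∀ q ∈ W, r (h s q) = r q := fun s q hq => by
    simp only [r]
    rw [hfh s q hq, mul_inv_rev, ← hh.act_mul, inv_mul_cancel_right]
  have hrfix : ∀ q, f q = 1 → r q = q := fun q hq => by
    simp only [r]; rw [hq, inv_one, hh.act_one]
  have hg : ContMDiffOn I 𝓘(ℝ, ℝ) ∞ (fun q => (f q : ℝ)) W :=
    (Units.contMDiff_val (n := ∞)).comp_contMDiffOn hf
  obtain ⟨ψ, hψ1, hψW, hψ, hψs, hψg⟩ := exists_chart_snd_eq hW hg (hrW q₀ hq₀)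
    (mfderiv_ne_zero_of_equivariant hh hW hf hfh (hrW q₀ hq₀) (hr1 q₀ hq₀))
  have hf1 : ∀ y, (y, (1 : ℝ)) ∈ ψ.target → f (ψ.symm (y, 1)) = 1 := fun y hy => by
    have := hψg _ (ψ.map_target hy)
    rw [ψ.right_inv hy] at this
    exact Units.ext this.symm
  have hψ1' : ∀ q ∈ W, r q ∈ ψ.source → ψ (r q) = ((ψ (r q)).1, 1) := fun q hq hq' => by
    refine Prod.ext rfl ?_
    rw [hψg _ hq', hr1 q hq, Units.val_one]
  have hmkcont : ContDiff ℝ ∞ (fun y : EuclideanSpace ℝ (Fin (finrank ℝ E - 1)) => (y, (1 : ℝ))) :=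
    contDiff_id.prodMk contDiff_const
  have hfst : ContMDiffOn I (𝓡 (finrank ℝ E - 1)) ∞ (fun q => (ψ (r q)).1)
      (W ∩ r ⁻¹' ψ.source) :=
    contDiff_fst.contMDiff.comp_contMDiffOn
      (hψ.comp (hr.mono inter_subset_left) inter_subset_right)
  have htoFun : ContMDiffOn I ((𝓡 (finrank ℝ E - 1)).prod 𝓘(ℝ, ℝ)) ∞
      (fun q => ((ψ (r q)).1, f q)) (W ∩ r ⁻¹' ψ.source) :=
    hfst.prodMk (hf.mono inter_subset_left)
  have hinvFun : ContMDiffOn ((𝓡 (finrank ℝ E - 1)).prod 𝓘(ℝ, ℝ)) I ∞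
      (fun z : EuclideanSpace ℝ (Fin (finrank ℝ E - 1)) × ℝˣ => h z.2 (ψ.symm (z.1, 1)))
      {z | (z.1, (1 : ℝ)) ∈ ψ.target} :=
    hh.contMDiff.comp_contMDiffOn (contMDiffOn_snd.prodMk
      (hψs.comp (hmkcont.contMDiff.comp_contMDiffOn contMDiffOn_fst) fun z hz => hz))
  let T : OpenPartialHomeomorph Q (EuclideanSpace ℝ (Fin (finrank ℝ E - 1)) × ℝˣ) :=
    { toFun := fun q => ((ψ (r q)).1, f q)
      invFun := fun z => h z.2 (ψ.symm (z.1, 1))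
      source := W ∩ r ⁻¹' ψ.source
      target := {z | (z.1, (1 : ℝ)) ∈ ψ.target}
      map_source' := fun q hq => by
        change ((ψ (r q)).1, (1 : ℝ)) ∈ ψ.target
        rw [← hψ1' q hq.1 hq.2]
        exact ψ.map_source hq.2
      map_target' := fun z hz => by
        have hz' := hψW (ψ.map_target hz)
        refine ⟨hWh _ _ hz', ?_⟩
        rw [mem_preimage, hrh _ _ hz', hrfix _ (hf1 _ hz)]
        exact ψ.map_target hz
      left_inv' := fun q hq => by
        change h (f q) (ψ.symm ((ψ (r q)).1, 1)) = q
        rw [← hψ1' q hq.1 hq.2, ψ.left_inv hq.2, hrinv]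
      right_inv' := fun z hz => by
        have hz' := hψW (ψ.map_target hz)
        change ((ψ (r (h z.2 (ψ.symm (z.1, 1))))).1, f (h z.2 (ψ.symm (z.1, 1)))) = z
        rw [hrh _ _ hz', hrfix _ (hf1 _ hz), hfh _ _ hz', hf1 _ hz, ψ.right_inv hz, mul_one]
      open_source := hr.continuousOn.isOpen_inter_preimage hW ψ.open_source
      open_target := ψ.open_target.preimage (hmkcont.continuous.comp continuous_fst)
      continuousOn_toFun := htoFun.continuousOn
      continuousOn_invFun := hinvFun.continuousOn }
  refine ⟨⟨T, fun s q hq => ⟨hWh s q hq.1, ?_⟩, fun s q hq => ?_, htoFun, hinvFun⟩, hq₀, hψ1⟩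
  · rw [mem_preimage, hrh s q hq.1]; exact hq.2
  · change ((ψ (r (h s q))).1, f (h s q)) = ((ψ (r q)).1, s * f q)
    rw [hrh s q hq.1, hfh s q hq.1]

end FlowBoxes

universe u v w

section OrbitSpace

variable {E : Type v} [NormedAddCommGroup E] [NormedSpace ℝ E]
  {H : Type w} [TopologicalSpace H] {I : ModelWithCorners ℝ E H}
  {Q : Type u} [TopologicalSpace Q] [ChartedSpace H Q] {h : ℝˣ → Q → Q}

/-- The equivalence relation whose classes are the orbits of an action. -/
def IsSmoothAction.orbitSetoid (hh : IsSmoothAction I h) : Setoid Q where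
  r p q := ∃ s, h s p = q
  iseqv :=
    { refl := fun p => ⟨1, hh.act_one p⟩
      symm := by
        rintro p _ ⟨s, rfl⟩
        exact ⟨s⁻¹, hh.act_inv_act s p⟩
      trans := by
        rintro p _ _ ⟨s, rfl⟩ ⟨t, rfl⟩
        exact ⟨t * s, hh.act_mul t s p⟩ }

/-- The orbit space of a smooth action. -/
def OrbitSpace (hh : IsSmoothAction I h) : Type u := Quotient hh.orbitSetoid

instance (hh : IsSmoothAction I h) : TopologicalSpace (OrbitSpace hh) :=
  inferInstanceAs (TopologicalSpace (Quotient hh.orbitSetoid))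

/-- The projection onto the orbit space. -/
def orbitMk (hh : IsSmoothAction I h) (q : Q) : OrbitSpace hh :=
  Quotient.mk hh.orbitSetoid q

namespace OrbitSpace

variable (hh : IsSmoothAction I h)

theorem mk_surjective : Function.Surjective (orbitMk hh) := Quotient.mk_surjective

theorem mk_eq_mk {p q : Q} : orbitMk hh p = orbitMk hh q ↔ ∃ s, h s p = q :=
  Quotient.eq (r := hh.orbitSetoid)

theorem mk_act (s : ℝˣ) (q : Q) : orbitMk hh (h s q) = orbitMk hh q :=
  ((mk_eq_mk hh).2 ⟨s, rfl⟩).symm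

theorem isOpenQuotientMap_mk : IsOpenQuotientMap (orbitMk hh) where
  surjective := mk_surjective hh
  continuous := continuous_quotient_mk'
  isOpenMap := fun U hU => by
    change IsOpen (orbitMk hh ⁻¹' (orbitMk hh '' U))
    have : orbitMk hh ⁻¹' (orbitMk hh '' U) = ⋃ s, h s ⁻¹' U := by
      ext q
      simp only [mem_preimage, mem_image, mem_iUnion]
      constructor
      · rintro ⟨p, hp, hpq⟩
        obtain ⟨s, rfl⟩ := (mk_eq_mk hh).1 hpq.symm
        exact ⟨s, hp⟩
      · rintro ⟨s, hs⟩
        exact ⟨h s q, hs, mk_act hh s q⟩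
    rw [this]
    exact isOpen_iUnion fun s => hU.preimage (hh.contMDiff_act s).continuous

theorem secondCountableTopology [SecondCountableTopology Q] :
    SecondCountableTopology (OrbitSpace hh) :=
  (isOpenQuotientMap_mk hh).isQuotientMap.secondCountableTopology
    (isOpenQuotientMap_mk hh).isOpenMap

end OrbitSpace

namespace FlowBox

open OrbitSpace

variable (hh : IsSmoothAction I h) {d : ℕ} (T : FlowBox I h d)

theorem mk_mem_image_iff {q : Q} : orbitMk hh q ∈ orbitMk hh '' T.chart.source ↔ q ∈ T.chart.source := by
  refine ⟨?_, fun hq => mem_image_of_mem _ hq⟩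
  rintro ⟨p, hp, hpq⟩
  obtain ⟨s, rfl⟩ := (mk_eq_mk hh).1 hpq
  exact T.act_mem s p hp

theorem mem_target_iff {y : EuclideanSpace ℝ (Fin d)} {s : ℝˣ} (hy : (y, (1 : ℝˣ)) ∈ T.chart.target) :
    (y, s) ∈ T.chart.target ∧ T.chart.symm (y, s) = h s (T.chart.symm (y, 1)) := by
  have h1 := T.chart.map_target hy
  have h2 := T.chart.map_source (T.act_mem s _ h1)
  have h3 : T.chart (h s (T.chart.symm (y, 1))) = (y, s) := by
    rw [T.chart_act s _ h1, T.chart.right_inv hy, mul_one]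
  rw [h3] at h2
  exact ⟨h2, by rw [← h3, T.chart.left_inv (T.act_mem s _ h1)]⟩

theorem mem_target_one {y : EuclideanSpace ℝ (Fin d)} {s : ℝˣ} (hy : (y, s) ∈ T.chart.target) :
    (y, (1 : ℝˣ)) ∈ T.chart.target := by
  have h1 := T.chart.map_target hy
  have h2 := T.chart.map_source (T.act_mem s⁻¹ _ h1)
  rwa [T.chart_act _ _ h1, T.chart.right_inv hy, inv_mul_cancel] at h2

theorem fst_chart_out (q : Q) (hq : q ∈ T.chart.source) :
    (T.chart (Function.surjInv (mk_surjective hh) (orbitMk hh q))).1 = (T.chart q).1 := by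
  obtain ⟨s, hs⟩ := (mk_eq_mk hh).1 (Function.surjInv_eq (mk_surjective hh) (orbitMk hh q)).symm
  rw [← hs, T.chart_act s q hq]

theorem mk_symm_eq {q : Q} (hq : q ∈ T.chart.source) (s : ℝˣ) :
    orbitMk hh (T.chart.symm ((T.chart q).1, s)) = orbitMk hh q := by
  have h1 : ((T.chart q).1, (1 : ℝˣ)) ∈ T.chart.target :=
    T.mem_target_one (T.chart.map_source hq)
  rw [(T.mem_target_iff h1).2, mk_act, ← mk_act hh (T.chart q).2, ← (T.mem_target_iff h1).2,
    Prod.mk.eta, T.chart.left_inv hq]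

/-- The chart of the orbit space induced by a flow box. -/
def baseChart : OpenPartialHomeomorph (OrbitSpace hh) (EuclideanSpace ℝ (Fin d)) where
  toFun x := (T.chart (Function.surjInv (mk_surjective hh) x)).1
  invFun y := orbitMk hh (T.chart.symm (y, 1))
  source := orbitMk hh '' T.chart.source
  target := {y | (y, (1 : ℝˣ)) ∈ T.chart.target}
  map_source' := by
    rintro _ ⟨q, hq, rfl⟩
    rw [T.fst_chart_out hh q hq]
    exact T.mem_target_one (T.chart.map_source hq)
  map_target' := fun y hy => mem_image_of_mem _ (T.chart.map_target hy)
  left_inv' := by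
    rintro _ ⟨q, hq, rfl⟩
    rw [T.fst_chart_out hh q hq, T.mk_symm_eq hh hq]
  right_inv' := fun y hy => by
    rw [T.fst_chart_out hh _ (T.chart.map_target hy), T.chart.right_inv hy]
  open_source := (isOpenQuotientMap_mk hh).isOpenMap _ T.chart.open_source
  open_target := T.chart.open_target.preimage (by fun_prop)
  continuousOn_toFun := by
    rintro _ ⟨q, hq, rfl⟩
    refine ContinuousAt.continuousWithinAt ?_
    rw [← (isOpenQuotientMap_mk hh).continuousAt_comp_iff]
    have h1 : ContinuousAt (fun q => (T.chart q).1) q :=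
      continuous_fst.continuousAt.comp (T.chart.continuousAt hq)
    refine h1.congr ?_
    filter_upwards [T.chart.open_source.mem_nhds hq] with p hp
    exact (T.fst_chart_out hh p hp).symm
  continuousOn_invFun := (isOpenQuotientMap_mk hh).continuous.comp_continuousOn
    (T.chart.continuousOn_symm.comp (by fun_prop) fun y hy => hy)

theorem baseChart_mk {q : Q} (hq : q ∈ T.chart.source) :
    T.baseChart hh (orbitMk hh q) = (T.chart q).1 :=
  T.fst_chart_out hh q hq

theorem mk_mem_baseChart_source {q : Q} :
    orbitMk hh q ∈ (T.baseChart hh).source ↔ q ∈ T.chart.source :=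
  T.mk_mem_image_iff hh

theorem contDiffOn_baseChart_transition (T' : FlowBox I h d) :
    ContDiffOn ℝ ∞ (T'.baseChart hh ∘ (T.baseChart hh).symm)
      ((T.baseChart hh).target ∩ (T.baseChart hh).symm ⁻¹' (T'.baseChart hh).source) := by
  have hmk : ContMDiff (𝓡 d) ((𝓡 d).prod 𝓘(ℝ, ℝ)) ∞
      (fun y : EuclideanSpace ℝ (Fin d) => (y, (1 : ℝˣ))) := contMDiff_id.prodMk contMDiff_const
  have h1 : ContMDiffOn (𝓡 d) (𝓡 d) ∞ (fun y => (T'.chart (T.chart.symm (y, 1))).1)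
      ((T.baseChart hh).target ∩ (T.baseChart hh).symm ⁻¹' (T'.baseChart hh).source) := by
    refine contMDiff_fst.comp_contMDiffOn (T'.contMDiffOn_chart.comp
      (T.contMDiffOn_symm.comp hmk.contMDiffOn fun y hy => hy.1) fun y hy => ?_)
    exact (T'.mk_mem_baseChart_source hh).1 hy.2
  refine h1.contDiffOn.congr fun y hy => ?_
  exact T'.baseChart_mk hh ((T'.mk_mem_baseChart_source hh).1 hy.2)

variable (hT : ∀ q, ∃ T : FlowBox I h d, q ∈ T.chart.source)

/-- A flow box around a given orbit. -/
def around (x : OrbitSpace hh) : FlowBox I h d :=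
  (hT (Function.surjInv (mk_surjective hh) x)).choose

theorem mem_around (x : OrbitSpace hh) : x ∈ ((around hh hT x).baseChart hh).source := by
  have := mem_image_of_mem (orbitMk hh) (hT (Function.surjInv (mk_surjective hh) x)).choose_spec
  rwa [Function.surjInv_eq (mk_surjective hh)] at this

/-- The atlas of the orbit space formed by the charts induced by flow boxes. -/
@[reducible]
def orbitChartedSpace : ChartedSpace (EuclideanSpace ℝ (Fin d)) (OrbitSpace hh) where
  atlas := range fun T : FlowBox I h d => T.baseChart hh
  chartAt x := (around hh hT x).baseChart hh
  mem_chart_source x := mem_around hh hT x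
  chart_mem_atlas _ := mem_range_self _

theorem isManifold_orbitSpace :
    @IsManifold ℝ _ _ _ _ _ _ (𝓡 d) ∞ (OrbitSpace hh) _ (orbitChartedSpace hh hT) := by
  let := orbitChartedSpace hh hT
  refine isManifold_of_contDiffOn (𝓡 d) ∞ (OrbitSpace hh) ?_
  rintro _ _ ⟨T, rfl⟩ ⟨T', rfl⟩
  simpa using T.contDiffOn_baseChart_transition hh T'

theorem contMDiff_mk :
    letI := orbitChartedSpace hh hT
    ContMDiff I (𝓡 d) ∞ (orbitMk hh) := by
  let := orbitChartedSpace hh hT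
  intro q
  rw [contMDiffAt_iff_target]
  refine ⟨(isOpenQuotientMap_mk hh).continuous.continuousAt, ?_⟩
  set T := around hh hT (orbitMk hh q)
  have hq : q ∈ T.chart.source := (T.mk_mem_baseChart_source hh).1 (mem_around hh hT (orbitMk hh q))
  have h1 : ContMDiffAt I (𝓡 d) ∞ (fun q => (T.chart q).1) q :=
    contMDiffAt_fst.comp q (T.contMDiffOn_chart.contMDiffAt (T.chart.open_source.mem_nhds hq))
  refine h1.congr_of_eventuallyEq ?_
  filter_upwards [T.chart.open_source.mem_nhds hq] with p hp
  exact T.baseChart_mk hh hp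

/-- The local trivialization of the projection onto the orbit space induced by a flow box. -/
def trivialization : Trivialization ℝˣ (orbitMk hh) where
  toFun q := (orbitMk hh q, (T.chart q).2)
  invFun z := T.chart.symm (T.baseChart hh z.1, z.2)
  source := T.chart.source
  target := (T.baseChart hh).source ×ˢ univ
  map_source' q hq := ⟨(T.mk_mem_baseChart_source hh).2 hq, mem_univ _⟩
  map_target' := by
    rintro ⟨_, s⟩ ⟨⟨q, hq, rfl⟩, -⟩
    refine T.chart.map_target ?_
    rw [T.baseChart_mk hh hq]
    exact (T.mem_target_iff (T.mem_target_one (T.chart.map_source hq))).1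
  left_inv' q hq := by
    rw [T.baseChart_mk hh hq, Prod.mk.eta, T.chart.left_inv hq]
  right_inv' := by
    rintro ⟨_, s⟩ ⟨⟨q, hq, rfl⟩, -⟩
    have h1 : ((T.chart q).1, s) ∈ T.chart.target :=
      (T.mem_target_iff (T.mem_target_one (T.chart.map_source hq))).1
    simp only
    rw [T.baseChart_mk hh hq, T.mk_symm_eq hh hq, T.chart.right_inv h1]
  open_source := T.chart.open_source
  open_target := (T.baseChart hh).open_source.prod isOpen_univ
  continuousOn_toFun := (isOpenQuotientMap_mk hh).continuous.continuousOn.prodMk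
    (continuous_snd.comp_continuousOn T.chart.continuousOn)
  continuousOn_invFun := by
    refine T.chart.continuousOn_symm.comp (((T.baseChart hh).continuousOn.comp
      continuousOn_fst fun z hz => hz.1).prodMk continuousOn_snd) ?_
    rintro ⟨_, s⟩ ⟨⟨q, hq, rfl⟩, -⟩
    simp only
    rw [T.baseChart_mk hh hq]
    exact (T.mem_target_iff (T.mem_target_one (T.chart.map_source hq))).1
  baseSet := (T.baseChart hh).source
  open_baseSet := (T.baseChart hh).open_source
  source_eq := by
    ext q
    exact (T.mk_mem_baseChart_source hh).symm
  target_eq := rfl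
  proj_toFun _ _ := rfl

theorem contMDiffOn_trivialization :
    letI := orbitChartedSpace hh hT
    ContMDiffOn I ((𝓡 d).prod 𝓘(ℝ, ℝ)) ∞ (T.trivialization hh) (T.trivialization hh).source := by
  let := orbitChartedSpace hh hT
  exact (contMDiff_mk hh hT).contMDiffOn.prodMk
    (contMDiff_snd.comp_contMDiffOn T.contMDiffOn_chart)

theorem contMDiffOn_trivialization_symm (x : OrbitSpace hh) :
    letI := orbitChartedSpace hh hT
    ContMDiffOn ((𝓡 d).prod 𝓘(ℝ, ℝ)) I ∞
      ((around hh hT x).trivialization hh).toOpenPartialHomeomorph.symm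
      ((around hh hT x).trivialization hh).target := by
  let := orbitChartedSpace hh hT
  have := isManifold_orbitSpace hh hT
  have h1 : ContMDiffOn (𝓡 d) (𝓡 d) ∞ ((around hh hT x).baseChart hh)
      ((around hh hT x).baseChart hh).source :=
    _root_.contMDiffOn_chart (I := 𝓡 d) (x := x)
  set T := around hh hT x
  refine T.contMDiffOn_symm.comp ((h1.comp contMDiffOn_fst fun z hz => hz.1).prodMk
    contMDiffOn_snd) ?_
  rintro ⟨_, s⟩ ⟨⟨q, hq, rfl⟩, -⟩
  change (T.baseChart hh (orbitMk hh q), s) ∈ T.chart.target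
  rw [T.baseChart_mk hh hq]
  exact (T.mem_target_iff (T.mem_target_one (T.chart.map_source hq))).1

end FlowBox

end OrbitSpace

/-- A smooth action covered by flow boxes whose orbit space is Hausdorff and second countable
makes the manifold an `ℝˣ`-principal bundle over the orbit space. -/
def RtPrincipalBundle.ofFlowBox {E : Type v} [NormedAddCommGroup E] [NormedSpace ℝ E]
    {H : Type w} [TopologicalSpace H] {I : ModelWithCorners ℝ E H}
    {Q : Type max u v} [TopologicalSpace Q] [ChartedSpace H Q] {h : ℝˣ → Q → Q}
    (hh : IsSmoothAction I h) [T2Space (OrbitSpace hh)]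
    [SecondCountableTopology (OrbitSpace hh)] {d : ℕ}
    (hT : ∀ q, ∃ T : FlowBox I h d, q ∈ T.chart.source) :
    RtPrincipalBundle I h :=
  letI := FlowBox.orbitChartedSpace hh hT
  { Base := OrbitSpace hh
    dimBase := d
    isManifoldBase := FlowBox.isManifold_orbitSpace hh hT
    proj := orbitMk hh
    act_one := hh.act_one
    act_mul := hh.act_mul
    contMDiff_act := hh.contMDiff
    contMDiff_proj := FlowBox.contMDiff_mk hh hT
    surjective_proj := OrbitSpace.mk_surjective hh
    proj_act := OrbitSpace.mk_act hh
    exists_trivialization := fun x =>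
      ⟨(FlowBox.around hh hT x).trivialization hh, FlowBox.mem_around hh hT x,
        FlowBox.contMDiffOn_trivialization hh _ hT,
        FlowBox.contMDiffOn_trivialization_symm hh hT x, fun s p hp => by
          change ((FlowBox.around hh hT x).chart (h s p)).2 =
            s * ((FlowBox.around hh hT x).chart p).2
          rw [(FlowBox.around hh hT x).chart_act s p hp]⟩ }

universe u' v' w'

section Separation

variable {B F Z : Type*} [TopologicalSpace B] [TopologicalSpace F] [TopologicalSpace Z]
  {proj : Z → B}

/-- A locally trivial space with Hausdorff base and fibre is Hausdorff. -/
theorem t2Space_of_trivialization [T2Space B] [T2Space F] (hproj : Continuous proj)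
    (he : ∀ x, ∃ e : Trivialization F proj, x ∈ e.baseSet) : T2Space Z := by
  refine ⟨fun z z' hz => ?_⟩
  by_cases hx : proj z = proj z'
  · obtain ⟨e, hxe⟩ := he (proj z)
    have hze : z ∈ e.source := e.mem_source.2 hxe
    have hze' : z' ∈ e.source := e.mem_source.2 (hx ▸ hxe)
    have hne : e z ≠ e z' := fun h => hz (e.injOn hze hze' h)
    obtain ⟨U, V, hU, hV, hzU, hzV, hUV⟩ := t2_separation hne
    exact ⟨e.source ∩ e ⁻¹' U, e.source ∩ e ⁻¹' V,
      e.toOpenPartialHomeomorph.isOpen_inter_preimage hU,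
      e.toOpenPartialHomeomorph.isOpen_inter_preimage hV, ⟨hze, hzU⟩, ⟨hze', hzV⟩,
      (hUV.preimage e).mono inter_subset_right inter_subset_right⟩
  · obtain ⟨U, V, hU, hV, hzU, hzV, hUV⟩ := t2_separation hx
    exact ⟨proj ⁻¹' U, proj ⁻¹' V, hU.preimage hproj, hV.preimage hproj, hzU, hzV,
      hUV.preimage proj⟩

/-- A locally trivial space with second countable base and fibre is second countable. -/
theorem secondCountableTopology_of_trivialization [SecondCountableTopology B]
    [SecondCountableTopology F] (he : ∀ x, ∃ e : Trivialization F proj, x ∈ e.baseSet) :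
    SecondCountableTopology Z := by
  choose e hxe using he
  obtain ⟨s, hs, hsU⟩ := TopologicalSpace.countable_cover_nhds
    (f := fun x => (e x).baseSet) fun x => (e x).open_baseSet.mem_nhds (hxe x)
  have : Countable s := hs.to_subtype
  have hsc : ∀ i : s, SecondCountableTopology (e i).source := fun i =>
    (e i).toOpenPartialHomeomorph.toHomeomorphSourceTarget.isInducing.secondCountableTopology
  refine TopologicalSpace.secondCountableTopology_of_countable_cover
    (U := fun i : s => (e i).source) (fun i => (e i).open_source) ?_
  refine eq_univ_of_forall fun z => ?_
  have hz : proj z ∈ ⋃ x ∈ s, (e x).baseSet := by rw [hsU]; trivial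
  obtain ⟨x, hx, hzx⟩ := mem_iUnion₂.1 hz
  exact mem_iUnion.2 ⟨⟨x, hx⟩, (e x).mem_source.2 hzx⟩

variable (F) (X : B → Type*) [∀ b, TopologicalSpace (X b)] [TopologicalSpace (TotalSpace F X)]
  [FiberBundle F X]

theorem t2Space_totalSpace [T2Space B] [T2Space F] : T2Space (TotalSpace F X) :=
  t2Space_of_trivialization (FiberBundle.continuous_proj F X) fun x =>
    ⟨trivializationAt F X x, FiberBundle.mem_baseSet_trivializationAt' x⟩

theorem secondCountableTopology_totalSpace [SecondCountableTopology B]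
    [SecondCountableTopology F] : SecondCountableTopology (TotalSpace F X) :=
  secondCountableTopology_of_trivialization fun x =>
    ⟨trivializationAt F X x, FiberBundle.mem_baseSet_trivializationAt' x⟩

end Separation

namespace RtPrincipalBundle

variable {E : Type v} [NormedAddCommGroup E] [NormedSpace ℝ E]
  {H : Type w} [TopologicalSpace H] {I : ModelWithCorners ℝ E H}
  {P : Type u} [TopologicalSpace P] [ChartedSpace H P] {h : ℝˣ → P → P}
  (B : RtPrincipalBundle I h)

include B

theorem isSmoothAction : IsSmoothAction I h := ⟨B.act_one, B.act_mul, B.contMDiff_act⟩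

theorem t2Space : T2Space P :=
  t2Space_of_trivialization B.contMDiff_proj.continuous fun x =>
    (B.exists_trivialization x).imp fun _ he => he.1

theorem secondCountableTopology : SecondCountableTopology P :=
  have : SecondCountableTopology ℝˣ :=
    Units.isOpenEmbedding_val.isInducing.secondCountableTopology
  secondCountableTopology_of_trivialization fun x =>
    (B.exists_trivialization x).imp fun _ he => he.1

theorem exists_act_eq {p q : P} (hpq : B.proj p = B.proj q) : ∃ s, h s p = q := by
  obtain ⟨e, hx, -, -, he⟩ := B.exists_trivialization (B.proj p)
  have hp : p ∈ e.source := e.mem_source.2 hx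
  have hq : q ∈ e.source := e.mem_source.2 (hpq ▸ hx)
  refine ⟨(e q).2 * (e p).2⁻¹, ?_⟩
  have hs : h ((e q).2 * (e p).2⁻¹) p ∈ e.source := e.mem_source.2 (by rwa [B.proj_act])
  refine e.injOn hs hq (Prod.ext ?_ ?_)
  · change (e _).1 = (e q).1
    rw [e.coe_fst hs, e.coe_fst hq, B.proj_act, hpq]
  · change (e _).2 = (e q).2
    rw [he _ p hp, inv_mul_cancel_right]

variable {E' : Type v'} [NormedAddCommGroup E'] [NormedSpace ℝ E']
  {H' : Type w'} [TopologicalSpace H'] {I' : ModelWithCorners ℝ E' H'}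
  {P' : Type u'} [TopologicalSpace P'] [ChartedSpace H' P'] {h' : ℝˣ → P' → P'}

/-- A smooth equivariant map of principal bundles covers a smooth map of the bases. -/
theorem isPrincipalMorphism (B' : RtPrincipalBundle I' h') {Φ : P → P'}
    (hΦ : ContMDiff I I' ∞ Φ) (hΦh : ∀ s p, Φ (h s p) = h' s (Φ p)) :
    IsPrincipalMorphism B B' Φ := by
  let φ : B.Base → B'.Base := fun x => B'.proj (Φ (Function.surjInv B.surjective_proj x))
  have hφ : ∀ p, B'.proj (Φ p) = φ (B.proj p) := fun p => by
    obtain ⟨s, hs⟩ := B.exists_act_eq (Function.surjInv_eq B.surjective_proj (B.proj p)).symm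
    change _ = B'.proj (Φ (Function.surjInv B.surjective_proj (B.proj p)))
    rw [← hs, hΦh, B'.proj_act]
  refine ⟨hΦ, hΦh, φ, fun x => ?_, hφ⟩
  obtain ⟨e, hx, -, hes, -⟩ := B.exists_trivialization x
  have hmk : ContMDiff (𝓡 B.dimBase) ((𝓡 B.dimBase).prod 𝓘(ℝ, ℝ)) ∞
      (fun y : B.Base => (y, (1 : ℝˣ))) := contMDiff_id.prodMk contMDiff_const
  have hmem : ∀ y ∈ e.baseSet, (y, (1 : ℝˣ)) ∈ e.target := fun y hy => e.mem_target.2 hy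
  have h1 : ContMDiffOn (𝓡 B.dimBase) (𝓡 B'.dimBase) ∞
      (fun y => B'.proj (Φ (e.toOpenPartialHomeomorph.symm (y, 1)))) e.baseSet :=
    (B'.contMDiff_proj.comp hΦ).comp_contMDiffOn (hes.comp hmk.contMDiffOn hmem)
  refine (h1.contMDiffAt (e.open_baseSet.mem_nhds hx)).congr_of_eventuallyEq ?_
  filter_upwards [e.open_baseSet.mem_nhds hx] with y hy
  rw [hφ, e.proj_symm_apply (hmem y hy)]

theorem isSurjectivePrincipalMorphism (B' : RtPrincipalBundle I' h') {Φ : P → P'}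
    (hΦ : ContMDiff I I' ∞ Φ) (hΦh : ∀ s p, Φ (h s p) = h' s (Φ p))
    (hsurj : Function.Surjective Φ) : IsSurjectivePrincipalMorphism B B' Φ :=
  ⟨B.isPrincipalMorphism B' hΦ hΦh, hsurj⟩

/-- A smooth equivariant map of principal bundles with smooth inverse is an isomorphism of
principal bundles. -/
theorem isPrincipalIsomorphism (B' : RtPrincipalBundle I' h') {Φ : P → P'} {Ψ : P' → P}
    (hΦ : ContMDiff I I' ∞ Φ) (hΦh : ∀ s p, Φ (h s p) = h' s (Φ p)) (hΨ : ContMDiff I' I ∞ Ψ)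
    (hl : Function.LeftInverse Ψ Φ) (hr : Function.RightInverse Ψ Φ) :
    IsPrincipalIsomorphism B B' Φ :=
  ⟨B.isPrincipalMorphism B' hΦ hΦh, Ψ, B'.isPrincipalMorphism B hΨ
    (fun s p => hl.injective (by rw [hr, hΦh, hr])), hl, hr⟩

/-- The orbit space of an action admitting a continuous equivariant map to a principal bundle is
Hausdorff. -/
theorem t2Space_orbitSpace [T2Space P'] (hh : IsSmoothAction I' h') {Φ : P' → P}
    (hΦ : Continuous Φ) (hΦh : ∀ s p, Φ (h' s p) = h s (Φ p)) : T2Space (OrbitSpace hh) := by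
  have key : ∀ {q q' : P'} {U V : Set P'}, IsOpen U → IsOpen V → (∀ s, ∀ p ∈ U, h' s p ∈ U) →
      q ∈ U → q' ∈ V → Disjoint U V → ∃ u v : Set (OrbitSpace hh), IsOpen u ∧ IsOpen v ∧
        orbitMk hh q ∈ u ∧ orbitMk hh q' ∈ v ∧ Disjoint u v := by
    intro q q' U V hU hV hUh hq hq' hUV
    have ho := (OrbitSpace.isOpenQuotientMap_mk hh).isOpenMap
    refine ⟨_, _, ho U hU, ho V hV, mem_image_of_mem _ hq, mem_image_of_mem _ hq', ?_⟩
    rw [Set.disjoint_left]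
    rintro _ ⟨p, hp, rfl⟩ ⟨p', hp', hpp⟩
    obtain ⟨s, rfl⟩ := (OrbitSpace.mk_eq_mk hh).1 hpp.symm
    exact Set.disjoint_left.1 hUV (hUh s p hp) hp'
  have hm : ∀ s p, B.proj (Φ (h' s p)) = B.proj (Φ p) := fun s p => by rw [hΦh, B.proj_act]
  have hmc : Continuous fun q => B.proj (Φ q) := B.contMDiff_proj.continuous.comp hΦ
  refine ⟨fun x x' hx => ?_⟩
  obtain ⟨q, rfl⟩ := OrbitSpace.mk_surjective hh x
  obtain ⟨q', rfl⟩ := OrbitSpace.mk_surjective hh x'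
  by_cases hqq : B.proj (Φ q) = B.proj (Φ q')
  · obtain ⟨e, hxe, -, -, he⟩ := B.exists_trivialization (B.proj (Φ q))
    let W : Set P' := Φ ⁻¹' e.source
    have hqW : q ∈ W := e.mem_source.2 hxe
    have hqW' : q' ∈ W := e.mem_source.2 (hqq ▸ hxe)
    have hW : IsOpen W := e.open_source.preimage hΦ
    have hWh : ∀ s, ∀ p ∈ W, h' s p ∈ W := fun s p hp =>
      e.mem_source.2 ((hm s p).symm ▸ e.mem_source.1 hp)
    let f : P' → ℝˣ := fun p => (e (Φ p)).2
    let r : P' → P' := fun p => h' (f p)⁻¹ p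
    have hrh : ∀ s, ∀ p ∈ W, r (h' s p) = r p := fun s p hp => by
      change h' (e (Φ (h' s p))).2⁻¹ (h' s p) = h' (e (Φ p)).2⁻¹ p
      rw [hΦh, he s _ hp, mul_inv_rev, ← hh.act_mul, inv_mul_cancel_right]
    have hfc : ContinuousOn f W := continuous_snd.comp_continuousOn
      (ContinuousOn.comp (t := e.source) (f := Φ) e.continuousOn_toFun hΦ.continuousOn fun p hp => hp)
    have hrc : ContinuousOn r W :=
      hh.contMDiff.continuous.comp_continuousOn (hfc.inv.prodMk continuousOn_id)
    have hne : r q ≠ r q' := fun hr => hx <| by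
      rw [← OrbitSpace.mk_act hh (f q)⁻¹ q, ← OrbitSpace.mk_act hh (f q')⁻¹ q']
      exact congrArg _ hr
    obtain ⟨U, V, hU, hV, hqU, hqV, hUV⟩ := t2_separation hne
    refine key (hrc.isOpen_inter_preimage hW hU) (hrc.isOpen_inter_preimage hW hV)
      (fun s p hp => ⟨hWh s p hp.1, ?_⟩) ⟨hqW, hqU⟩ ⟨hqW', hqV⟩
      ((hUV.preimage r).mono inter_subset_right inter_subset_right)
    rw [mem_preimage, hrh s p hp.1]
    exact hp.2
  · obtain ⟨U, V, hU, hV, hqU, hqV, hUV⟩ := t2_separation hqq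
    refine key (hU.preimage hmc) (hV.preimage hmc) (fun s p hp => ?_) hqU hqV (hUV.preimage _)
    rw [mem_preimage, hm]
    exact hp

/-- An `ℝˣ`-manifold admitting a smooth equivariant map to a principal bundle is a principal
bundle. -/
theorem nonempty_of_equivariant {E' : Type v'} [NormedAddCommGroup E'] [NormedSpace ℝ E']
    [FiniteDimensional ℝ E'] {H' : Type w'} [TopologicalSpace H'] {I' : ModelWithCorners ℝ E' H'}
    [I'.Boundaryless] {P' : Type max u' v'} [TopologicalSpace P'] [ChartedSpace H' P']
    [IsManifold I' ∞ P'] [T2Space P'] [SecondCountableTopology P'] {h' : ℝˣ → P' → P'}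
    (hh : IsSmoothAction I' h') {Φ : P' → P}
    (hΦ : ContMDiff I' I ∞ Φ) (hΦh : ∀ s p, Φ (h' s p) = h s (Φ p)) :
    Nonempty (RtPrincipalBundle I' h') := by
  have := B.t2Space_orbitSpace hh hΦ.continuous hΦh
  have := OrbitSpace.secondCountableTopology hh
  refine ⟨RtPrincipalBundle.ofFlowBox.{u'} hh (d := finrank ℝ E' - 1) fun q => ?_⟩
  obtain ⟨e, hxe, hes, -, he⟩ := B.exists_trivialization (B.proj (Φ q))
  refine exists_flowBox hh (W := Φ ⁻¹' e.source) (e.open_source.preimage hΦ.continuous)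
    (fun s p hp => ?_) (f := fun p => (e (Φ p)).2)
    (contMDiff_snd.comp_contMDiffOn (hes.comp hΦ.contMDiffOn fun p hp => hp))
    (fun s p hp => ?_) (e.mem_source.2 hxe)
  · refine e.mem_source.2 ?_
    rw [hΦh, B.proj_act]
    exact e.mem_source.1 hp
  · rw [hΦh, he s _ hp]

end RtPrincipalBundle

section RawDerivative

variable {E : Type*} [NormedAddCommGroup E] [NormedSpace ℝ E]
  {H : Type*} [TopologicalSpace H] (I : ModelWithCorners ℝ E H)
  {M : Type*} [TopologicalSpace M] [ChartedSpace H M]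
  {E' : Type*} [NormedAddCommGroup E'] [NormedSpace ℝ E']
  {H' : Type*} [TopologicalSpace H'] (I' : ModelWithCorners ℝ E' H')
  {M' : Type*} [TopologicalSpace M'] [ChartedSpace H' M']
  {E'' : Type*} [NormedAddCommGroup E''] [NormedSpace ℝ E'']
  {H'' : Type*} [TopologicalSpace H''] (I'' : ModelWithCorners ℝ E'' H'')
  {M'' : Type*} [TopologicalSpace M''] [ChartedSpace H'' M'']

/-- The manifold derivative, regarded as a linear map between the model vector spaces. -/
def modelDeriv (f : M → M') (x : M) : E →L[ℝ] E' := mfderiv I I' f x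

variable {I I' I''}

theorem modelDeriv_comp {g : M' → M''} {f : M → M'} {x : M}
    (hg : MDifferentiableAt I' I'' g (f x)) (hf : MDifferentiableAt I I' f x) :
    modelDeriv I I'' (g ∘ f) x = modelDeriv I' I'' g (f x) ∘L modelDeriv I I' f x :=
  mfderiv_comp x hg hf

theorem modelDeriv_congr {f g : M → M'} {x : M} (hfg : f =ᶠ[𝓝 x] g) :
    modelDeriv I I' f x = modelDeriv I I' g x :=
  hfg.mfderiv_eq

theorem modelDeriv_id (x : M) : modelDeriv I I (id : M → M) x = ContinuousLinearMap.id ℝ E :=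
  mfderiv_id

theorem modelDeriv_eq_fderiv (f : E → E') (x : E) :
    modelDeriv 𝓘(ℝ, E) 𝓘(ℝ, E') f x = fderiv ℝ f x :=
  mfderiv_eq_fderiv

theorem modelDeriv_eq_fderiv_chart [I.Boundaryless] {f : M → M'} {x : M}
    (hf : MDifferentiableAt I I' f x) :
    modelDeriv I I' f x =
      fderiv ℝ (extChartAt I' (f x) ∘ f ∘ (extChartAt I x).symm) (extChartAt I x x) := by
  rw [← fderivWithin_univ, ← I.range_eq_univ]
  exact hf.mfderiv

theorem modelDeriv_comp_eq_id {g : M' → M} {f : M → M'} {x : M}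
    (hg : MDifferentiableAt I' I g (f x)) (hf : MDifferentiableAt I I' f x)
    (hgf : ∀ᶠ y in 𝓝 x, g (f y) = y) :
    modelDeriv I' I g (f x) ∘L modelDeriv I I' f x = ContinuousLinearMap.id ℝ E := by
  rw [← modelDeriv_comp hg hf, ← modelDeriv_id (I := I) x]
  exact modelDeriv_congr hgf

end RawDerivative

section Charts

variable {E : Type*} [NormedAddCommGroup E] [NormedSpace ℝ E]
  {H : Type*} [TopologicalSpace H] {I : ModelWithCorners ℝ E H}
  {P : Type*} [TopologicalSpace P] [ChartedSpace H P] [IsManifold I ∞ P]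

theorem modelDeriv_extChartAt_self [I.Boundaryless] (x : P) :
    modelDeriv I 𝓘(ℝ, E) (extChartAt I x) x = ContinuousLinearMap.id ℝ E := by
  rw [modelDeriv_eq_fderiv_chart (mdifferentiableAt_extChartAt (mem_chart_source H x))]
  have : (extChartAt 𝓘(ℝ, E) (extChartAt I x x) ∘ extChartAt I x ∘ (extChartAt I x).symm)
      =ᶠ[𝓝 (extChartAt I x x)] id := by
    filter_upwards [extChartAt_target_mem_nhds x] with y hy
    exact (extChartAt I x).right_inv hy
  rw [this.fderiv_eq, fderiv_id]

theorem tangent_extChartAt_source (u : TangentBundle I P) :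
    (extChartAt I.tangent u).source = {v | v.proj ∈ (chartAt H u.proj).source} := by
  rw [FiberBundle.extChartAt]
  ext v
  simp

theorem cotangent_extChartAt_source (α : CotangentBundle I P) :
    (extChartAt (cotangentModel I) α).source = {β | β.proj ∈ (chartAt H α.proj).source} := by
  rw [FiberBundle.extChartAt]
  ext v
  simp only [mfld_simps, mem_ofPred_eq]
  exact ⟨fun hv => hv.2, fun hv => ⟨⟨hv, trivial⟩, hv⟩⟩

theorem tangent_extChartAt_apply (u v : TangentBundle I P)
    (hv : v.proj ∈ (chartAt H u.proj).source) :
    extChartAt I.tangent u v = (extChartAt I u.proj v.proj,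
      modelDeriv I 𝓘(ℝ, E) (extChartAt I u.proj) v.proj v.2) := by
  rw [FiberBundle.extChartAt]
  refine Prod.ext rfl ?_
  change (trivializationAt E (TangentSpace I) u.proj v).2 = _
  have h1 := TangentBundle.continuousLinearMapAt_trivializationAt (I := I) hv
  have h2 : (trivializationAt E (TangentSpace I) u.proj v).2 =
      (trivializationAt E (TangentSpace I) u.proj).continuousLinearMapAt ℝ v.proj v.2 := by
    rw [Trivialization.continuousLinearMapAt_apply_of_mem]
    simpa using hv
  rw [h2, h1]
  rfl

theorem cotangent_extChartAt_apply [I.Boundaryless] (α β : CotangentBundle I P)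
    (hβ : β.proj ∈ (chartAt H α.proj).source) :
    extChartAt (cotangentModel I) α β = (extChartAt I α.proj β.proj,
      (show E →L[ℝ] ℝ from β.2) ∘L
        modelDeriv 𝓘(ℝ, E) I (extChartAt I α.proj).symm (extChartAt I α.proj β.proj)) := by
  rw [FiberBundle.extChartAt]
  refine Prod.ext rfl ?_
  change (trivializationAt (E →L[ℝ] ℝ)
    (fun p : P => TangentSpace I p →L[ℝ] Bundle.Trivial P ℝ p) α.proj β).2 = _
  rw [hom_trivializationAt_apply]
  have h1 := TangentBundle.symmL_trivializationAt (I := I) hβ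
  rw [I.range_eq_univ, mfderivWithin_univ] at h1
  simp only [ContinuousLinearMap.inCoordinates]
  rw [h1]
  simp
  rfl

theorem mdifferentiableAt_extChartAt_symm [I.Boundaryless] {x : P} {y : E}
    (hy : y ∈ (extChartAt I x).target) :
    MDifferentiableAt 𝓘(ℝ, E) I (extChartAt I x).symm y :=
  ((contMDiffOn_extChartAt_symm (n := ∞) x).contMDiffAt
    ((isOpen_extChartAt_target x).mem_nhds hy)).mdifferentiableAt (by simp)

theorem modelDeriv_extChartAt_comp_symm [I.Boundaryless] {x : P} {y : E}
    (hy : y ∈ (extChartAt I x).target) :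
    modelDeriv I 𝓘(ℝ, E) (extChartAt I x) ((extChartAt I x).symm y) ∘L
      modelDeriv 𝓘(ℝ, E) I (extChartAt I x).symm y = ContinuousLinearMap.id ℝ E := by
  refine modelDeriv_comp_eq_id (mdifferentiableAt_extChartAt ?_)
    (mdifferentiableAt_extChartAt_symm hy) ?_
  · simpa using (extChartAt I x).map_target hy
  · filter_upwards [(isOpen_extChartAt_target x).mem_nhds hy] with z hz
    exact (extChartAt I x).right_inv hz

theorem modelDeriv_extChartAt_symm_comp [I.Boundaryless] {x p : P}
    (hp : p ∈ (chartAt H x).source) :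
    modelDeriv 𝓘(ℝ, E) I (extChartAt I x).symm (extChartAt I x p) ∘L
      modelDeriv I 𝓘(ℝ, E) (extChartAt I x) p = ContinuousLinearMap.id ℝ E := by
  have hp' : p ∈ (extChartAt I x).source := by simpa using hp
  refine modelDeriv_comp_eq_id
    (mdifferentiableAt_extChartAt_symm ((extChartAt I x).map_source hp'))
    (mdifferentiableAt_extChartAt hp) ?_
  filter_upwards [(isOpen_extChartAt_source x).mem_nhds hp'] with z hz
  exact (extChartAt I x).left_inv hz

theorem tangent_extChartAt_symm_apply [I.Boundaryless] (u : TangentBundle I P) {y : E}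
    (hy : y ∈ (extChartAt I u.proj).target) (a : E) :
    (extChartAt I.tangent u).symm (y, a) = ⟨(extChartAt I u.proj).symm y,
      modelDeriv 𝓘(ℝ, E) I (extChartAt I u.proj).symm y a⟩ := by
  have hsrc := (extChartAt I u.proj).map_target hy
  rw [extChartAt_source] at hsrc
  set w : TangentBundle I P := ⟨(extChartAt I u.proj).symm y,
      modelDeriv 𝓘(ℝ, E) I (extChartAt I u.proj).symm y a⟩
  have hw : w ∈ (extChartAt I.tangent u).source := by
    rw [tangent_extChartAt_source]; exact hsrc
  rw [← (extChartAt I.tangent u).left_inv hw, tangent_extChartAt_apply u w hsrc]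
  congr 2
  · exact ((extChartAt I u.proj).right_inv hy).symm
  · exact (DFunLike.congr_fun (modelDeriv_extChartAt_comp_symm hy) a).symm

theorem cotangent_extChartAt_symm_apply [I.Boundaryless] (α : CotangentBundle I P) {y : E}
    (hy : y ∈ (extChartAt I α.proj).target) (p : E →L[ℝ] ℝ) :
    (extChartAt (cotangentModel I) α).symm (y, p) = ⟨(extChartAt I α.proj).symm y,
      p ∘L modelDeriv I 𝓘(ℝ, E) (extChartAt I α.proj) ((extChartAt I α.proj).symm y)⟩ := by
  have hsrc := (extChartAt I α.proj).map_target hy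
  rw [extChartAt_source] at hsrc
  set w : CotangentBundle I P := ⟨(extChartAt I α.proj).symm y,
      p ∘L modelDeriv I 𝓘(ℝ, E) (extChartAt I α.proj) ((extChartAt I α.proj).symm y)⟩
  have hw : w ∈ (extChartAt (cotangentModel I) α).source := by
    rw [cotangent_extChartAt_source]; exact hsrc
  have hy' : extChartAt I α.proj w.proj = y := (extChartAt I α.proj).right_inv hy
  rw [← (extChartAt (cotangentModel I) α).left_inv hw, cotangent_extChartAt_apply α w hsrc, hy']
  congr 2
  ext b
  exact congrArg p (DFunLike.congr_fun (modelDeriv_extChartAt_comp_symm hy) b).symm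

variable {E' : Type*} [NormedAddCommGroup E'] [NormedSpace ℝ E']
  {H' : Type*} [TopologicalSpace H'] {I' : ModelWithCorners ℝ E' H'}
  {P' : Type*} [TopologicalSpace P'] [ChartedSpace H' P'] [IsManifold I' ∞ P']

variable (I I') in
/-- The covector lift of a map `f : P → P'` with inverse `g`, multiplied by `s`. -/
def cotangentLift (f : P → P') (g : P' → P) (s : ℝ) (α : CotangentBundle I P) :
    CotangentBundle I' P' :=
  ⟨f α.proj, s • ((show E →L[ℝ] ℝ from α.2) ∘L modelDeriv I' I g (f α.proj))⟩

variable (I I') in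
/-- The expression of a map in the preferred charts around two points. -/
def chartRep (x : P) (x' : P') (f : P → P') : E → E' :=
  extChartAt I' x' ∘ f ∘ (extChartAt I x).symm

theorem fderiv_chartRep [I.Boundaryless] {x : P} {x' : P'} {f : P → P'} {y : E}
    (hy : y ∈ (extChartAt I x).target) (hf : MDifferentiableAt I I' f ((extChartAt I x).symm y))
    (hfy : f ((extChartAt I x).symm y) ∈ (chartAt H' x').source) :
    fderiv ℝ (chartRep I I' x x' f) y =
      modelDeriv I' 𝓘(ℝ, E') (extChartAt I' x') (f ((extChartAt I x).symm y)) ∘L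
        modelDeriv I I' f ((extChartAt I x).symm y) ∘L
          modelDeriv 𝓘(ℝ, E) I (extChartAt I x).symm y := by
  rw [← modelDeriv_eq_fderiv, chartRep,
    ← modelDeriv_comp hf (mdifferentiableAt_extChartAt_symm hy)]
  exact modelDeriv_comp (mdifferentiableAt_extChartAt hfy)
    (hf.comp y (mdifferentiableAt_extChartAt_symm hy))

/-- The tangent lift of a map in charts. -/
theorem extChartAt_tangentMap [I.Boundaryless] (u : TangentBundle I P) (u' : TangentBundle I' P')
    {f : P → P'} {y : E} (hy : y ∈ (extChartAt I u.proj).target)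
    (hf : MDifferentiableAt I I' f ((extChartAt I u.proj).symm y))
    (hfy : f ((extChartAt I u.proj).symm y) ∈ (chartAt H' u'.proj).source) (a : E) :
    extChartAt I'.tangent u' (tangentMap I I' f ((extChartAt I.tangent u).symm (y, a))) =
      (chartRep I I' u.proj u'.proj f y, fderiv ℝ (chartRep I I' u.proj u'.proj f) y a) := by
  rw [tangent_extChartAt_symm_apply u hy, fderiv_chartRep hy hf hfy]
  exact tangent_extChartAt_apply u' _ hfy

/-- The covector lift of a map in charts. -/
theorem extChartAt_cotangentLift [I.Boundaryless] [I'.Boundaryless] (α : CotangentBundle I P)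
    (α' : CotangentBundle I' P') {f : P → P'} {g : P' → P} (s : ℝ) {y : E}
    (hy : y ∈ (extChartAt I α.proj).target)
    (hg : MDifferentiableAt I' I g (f ((extChartAt I α.proj).symm y)))
    (hfy : f ((extChartAt I α.proj).symm y) ∈ (chartAt H' α'.proj).source)
    (hgf : g (f ((extChartAt I α.proj).symm y)) = (extChartAt I α.proj).symm y) (p : E →L[ℝ] ℝ) :
    extChartAt (cotangentModel I') α'
        (cotangentLift I I' f g s ((extChartAt (cotangentModel I) α).symm (y, p))) =
      (chartRep I I' α.proj α'.proj f y, s • (p ∘L fderiv ℝ (chartRep I' I α'.proj α.proj g)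
        (chartRep I I' α.proj α'.proj f y))) := by
  have hfy' : f ((extChartAt I α.proj).symm y) ∈ (extChartAt I' α'.proj).source := by
    simpa using hfy
  have hF : chartRep I I' α.proj α'.proj f y =
    extChartAt I' α'.proj (f ((extChartAt I α.proj).symm y)) := rfl
  have hF' : (extChartAt I' α'.proj).symm (chartRep I I' α.proj α'.proj f y) =
    f ((extChartAt I α.proj).symm y) := (extChartAt I' α'.proj).left_inv hfy'
  have hsrc := (extChartAt I α.proj).map_target hy
  rw [extChartAt_source] at hsrc
  rw [cotangent_extChartAt_symm_apply α hy, fderiv_chartRep, hF', hgf]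
  · exact cotangent_extChartAt_apply α' _ hfy
  · exact (extChartAt I' α'.proj).map_source hfy'
  · rwa [hF']
  · rwa [hF', hgf]

end Charts

section Lifts

variable {E : Type*} [NormedAddCommGroup E] [NormedSpace ℝ E]
  {H : Type*} [TopologicalSpace H] {I : ModelWithCorners ℝ E H}
  {P : Type*} [TopologicalSpace P] [ChartedSpace H P] [IsManifold I ∞ P]
  {h : ℝˣ → P → P}

omit [IsManifold I ∞ P] in
theorem TangentBundle.mk_eq_mk {p q : P} (hpq : p = q) {a b : E} (hab : a = b) :
    (⟨p, a⟩ : TangentBundle I P) = ⟨q, b⟩ := by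
  subst hpq hab; rfl

omit [IsManifold I ∞ P] in
theorem CotangentBundle.mk_eq_mk {p q : P} (hpq : p = q) {a b : E →L[ℝ] ℝ} (hab : a = b) :
    (⟨p, a⟩ : CotangentBundle I P) = ⟨q, b⟩ := by
  subst hpq hab; rfl

theorem IsSmoothAction.tangentLift (hh : IsSmoothAction I h) :
    IsSmoothAction I.tangent (tangentLift I h) where
  act_one v := by
    have : h 1 = id := funext hh.act_one
    rw [Tulczyjew.tangentLift, this, tangentMap_id]
    rfl
  act_mul s t v := by
    have : h (s * t) = h s ∘ h t := funext (hh.act_mul s t)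
    rw [Tulczyjew.tangentLift, this]
    exact tangentMap_comp_at v ((hh.contMDiff_act s).mdifferentiableAt (by simp))
      ((hh.contMDiff_act t).mdifferentiableAt (by simp))
  contMDiff := by
    intro x₀
    have hb : ContMDiff (𝓘(ℝ, ℝ).prod I.tangent) I ∞
        (fun x : ℝˣ × TangentBundle I P => x.2.proj) :=
      (contMDiff_proj (TangentSpace I)).comp contMDiff_snd
    have hv : ContMDiffAt (𝓘(ℝ, ℝ).prod I.tangent) I.tangent ∞
        (fun x : ℝˣ × TangentBundle I P => (⟨x.2.proj, x.2.2⟩ : TangentBundle I P)) x₀ :=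
      contMDiffAt_snd
    have hb₂ : ContMDiffAt (𝓘(ℝ, ℝ).prod I.tangent) I ∞
        (fun x : ℝˣ × TangentBundle I P => h x.1 x.2.proj) x₀ :=
      (hh.contMDiff.comp (contMDiff_fst.prodMk hb)).contMDiffAt
    have hϕ := ContMDiffAt.mfderiv (x₀ := x₀) (m := ∞) (n := ∞) (I := I) (I' := I)
      (fun x : ℝˣ × TangentBundle I P => h x.1) (fun x => x.2.proj)
      ((hh.contMDiff.comp (contMDiff_fst.fst.prodMk contMDiff_snd)).contMDiffAt)
      hb.contMDiffAt (by simp)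
    exact ContMDiffAt.clm_apply_of_inCoordinates hϕ hv hb₂

omit [IsManifold I ∞ P] in
theorem phaseLift_eq (s : ℝˣ) : phaseLift I h s = cotangentLift I I (h s) (h s⁻¹) (s : ℝ) := rfl

theorem cotangent_trivializationAt_snd [I.Boundaryless] (x : P) (β : CotangentBundle I P)
    (hβ : β.proj ∈ (chartAt H x).source) :
    (trivializationAt (E →L[ℝ] ℝ) (fun p : P => TangentSpace I p →L[ℝ] Bundle.Trivial P ℝ p)
      x β).2 = (show E →L[ℝ] ℝ from β.2) ∘L
        modelDeriv 𝓘(ℝ, E) I (extChartAt I x).symm (extChartAt I x β.proj) := by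
  have h1 := cotangent_extChartAt_apply (⟨x, 0⟩ : CotangentBundle I P) β hβ
  rw [FiberBundle.extChartAt] at h1
  exact congrArg Prod.snd h1

theorem contMDiffAt_cotangent_trivializationAt_snd (x : P) (β : CotangentBundle I P)
    (hβ : β.proj ∈ (chartAt H x).source) :
    ContMDiffAt (cotangentModel I) 𝓘(ℝ, E →L[ℝ] ℝ) ∞ (fun β : CotangentBundle I P =>
      (trivializationAt (E →L[ℝ] ℝ) (fun p : P => TangentSpace I p →L[ℝ] Bundle.Trivial P ℝ p)
        x β).2) β := by
  have h1 : ContMDiffAt (cotangentModel I) (cotangentModel I) ∞ (trivializationAt (E →L[ℝ] ℝ)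
      (fun p : P => TangentSpace I p →L[ℝ] Bundle.Trivial P ℝ p) x) β :=
    (Trivialization.contMDiffOn _).contMDiffAt
      ((trivializationAt _ _ x).open_source.mem_nhds (by
        rw [Trivialization.mem_source, hom_trivializationAt_baseSet]
        exact ⟨hβ, trivial⟩))
  exact contMDiffAt_snd.comp β h1

theorem inTangentCoordinates_eq_modelDeriv [I.Boundaryless] {N : Type*} {k : N → P → P} {g : N → P}
    {x₀ x : N} (hx : g x ∈ (chartAt H (g x₀)).source)
    (hkx : k x (g x) ∈ (chartAt H (k x₀ (g x₀))).source) :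
    inTangentCoordinates I I g (fun x => k x (g x)) (fun x => mfderiv I I (k x) (g x)) x₀ x =
      modelDeriv I 𝓘(ℝ, E) (extChartAt I (k x₀ (g x₀))) (k x (g x)) ∘L
        modelDeriv I I (k x) (g x) ∘L
          modelDeriv 𝓘(ℝ, E) I (extChartAt I (g x₀)).symm (extChartAt I (g x₀) (g x)) := by
  refine (inTangentCoordinates_eq_mfderiv_comp hx hkx).trans ?_
  rw [I.range_eq_univ, mfderivWithin_univ]
  rfl

theorem IsSmoothAction.phaseLift [I.Boundaryless] (hh : IsSmoothAction I h) :
    IsSmoothAction (cotangentModel I) (phaseLift I h) where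
  act_one α := by
    have h1 : h 1 = id := funext hh.act_one
    have h2 : h 1⁻¹ = id := by rw [inv_one, h1]
    rw [phaseLift_eq, h1, h2]
    refine CotangentBundle.mk_eq_mk rfl ?_
    rw [modelDeriv_id, Units.val_one, one_smul, ContinuousLinearMap.comp_id]
  act_mul s t α := by
    have h1 : h (s * t)⁻¹ = h t⁻¹ ∘ h s⁻¹ := by
      rw [mul_inv_rev]; exact funext (hh.act_mul _ _)
    refine CotangentBundle.mk_eq_mk (hh.act_mul s t α.proj) ?_
    have h2 : modelDeriv I I (h t⁻¹ ∘ h s⁻¹) (h s (h t α.proj)) =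
        modelDeriv I I (h t⁻¹) (h t α.proj) ∘L modelDeriv I I (h s⁻¹) (h s (h t α.proj)) := by
      have := modelDeriv_comp (x := h s (h t α.proj))
        ((hh.contMDiff_act t⁻¹).mdifferentiableAt (by simp))
        ((hh.contMDiff_act s⁻¹).mdifferentiableAt (by simp))
      rwa [hh.act_inv_act] at this
    change ((s * t : ℝˣ) : ℝ) • ((show E →L[ℝ] ℝ from α.2) ∘L
        modelDeriv I I (h (s * t)⁻¹) (h (s * t) α.proj)) =
      (s : ℝ) • (((t : ℝ) • ((show E →L[ℝ] ℝ from α.2) ∘L modelDeriv I I (h t⁻¹) (h t α.proj))) ∘L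
        modelDeriv I I (h s⁻¹) (h s (h t α.proj)))
    rw [h1, hh.act_mul, h2, Units.val_mul, mul_smul, ContinuousLinearMap.smul_comp,
      ContinuousLinearMap.comp_assoc]
  contMDiff := by
    intro x₀
    have hpr : ContMDiff (𝓘(ℝ, ℝ).prod (cotangentModel I)) I ∞
        (fun x : ℝˣ × CotangentBundle I P => x.2.proj) :=
      (contMDiff_proj (fun p : P => TangentSpace I p →L[ℝ] Bundle.Trivial P ℝ p)).comp
        contMDiff_snd
    have hb : ContMDiff (𝓘(ℝ, ℝ).prod (cotangentModel I)) I ∞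
        (fun x : ℝˣ × CotangentBundle I P => h x.1 x.2.proj) :=
      hh.contMDiff.comp (contMDiff_fst.prodMk hpr)
    refine contMDiffAt_totalSpace.2 ⟨hb.contMDiffAt, ?_⟩
    have hϕ := ContMDiffAt.mfderiv (x₀ := x₀) (m := ∞) (n := ∞) (I := I) (I' := I)
      (fun x : ℝˣ × CotangentBundle I P => h x.1⁻¹) (fun x => h x.1 x.2.proj)
      ((hh.contMDiff.comp (contMDiff_fst.fst.inv.prodMk contMDiff_snd)).contMDiffAt)
      hb.contMDiffAt (by simp)
    set c := h x₀.1⁻¹ (h x₀.1 x₀.2.proj) with hc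
    have hc' : c = x₀.2.proj := hh.act_inv_act _ _
    have hα : ContMDiffAt (𝓘(ℝ, ℝ).prod (cotangentModel I)) 𝓘(ℝ, E →L[ℝ] ℝ) ∞
        (fun x : ℝˣ × CotangentBundle I P => (trivializationAt (E →L[ℝ] ℝ)
          (fun p : P => TangentSpace I p →L[ℝ] Bundle.Trivial P ℝ p) c x.2).2) x₀ :=
      (contMDiffAt_cotangent_trivializationAt_snd c x₀.2
        (by rw [hc']; exact mem_chart_source H _)).comp x₀ contMDiffAt_snd
    have hs : ContMDiffAt (𝓘(ℝ, ℝ).prod (cotangentModel I)) 𝓘(ℝ, ℝ) ∞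
        (fun x : ℝˣ × CotangentBundle I P => (x.1 : ℝ)) x₀ :=
      (Units.contMDiff_val.comp contMDiff_fst).contMDiffAt
    have hsm := hs.smul (hα.clm_comp hϕ)
    refine hsm.congr_of_eventuallyEq ?_
    have e1 : ∀ᶠ x in 𝓝 x₀, h x.1 x.2.proj ∈ (chartAt H (h x₀.1 x₀.2.proj)).source :=
      hb.continuous.continuousAt.eventually
        ((chartAt H _).open_source.mem_nhds (mem_chart_source H _))
    have e2 : ∀ᶠ x in 𝓝 x₀, x.2.proj ∈ (chartAt H c).source :=
      hpr.continuous.continuousAt.eventually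
        ((chartAt H _).open_source.mem_nhds (by rw [hc']; exact mem_chart_source H _))
    filter_upwards [e1, e2] with x hx1 hx2
    have hx2' : h x.1⁻¹ (h x.1 x.2.proj) ∈ (chartAt H c).source := by rwa [hh.act_inv_act]
    refine (cotangent_trivializationAt_snd (h x₀.1 x₀.2.proj) (Tulczyjew.phaseLift I h x.1 x.2)
      hx1).trans ?_
    refine Eq.trans ?_ (congrArg₂ (fun (p : E →L[ℝ] ℝ) (A : E →L[ℝ] E) => (x.1 : ℝ) • (p ∘L A))
      (cotangent_trivializationAt_snd c x.2 hx2) (inTangentCoordinates_eq_modelDeriv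
        (k := fun x : ℝˣ × CotangentBundle I P => h x.1⁻¹) (g := fun x => h x.1 x.2.proj)
        hx1 hx2')).symm
    have h3 := modelDeriv_extChartAt_symm_comp (I := I) hx2
    ext a
    have h4 := DFunLike.congr_fun h3 (modelDeriv I I (h x.1⁻¹) (h x.1 x.2.proj)
      (modelDeriv 𝓘(ℝ, E) I (extChartAt I (h x₀.1 x₀.2.proj)).symm
        (extChartAt I (h x₀.1 x₀.2.proj) (h x.1 x.2.proj)) a))
    have h5 : modelDeriv I 𝓘(ℝ, E) (extChartAt I c) (h x.1⁻¹ (h x.1 x.2.proj)) =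
      modelDeriv I 𝓘(ℝ, E) (extChartAt I c) x.2.proj := by rw [hh.act_inv_act]
    rw [← h5] at h4
    exact congrArg (fun b => (x.1 : ℝ) • (show E →L[ℝ] ℝ from x.2.2) b) h4.symm

end Lifts

section VectorSpace

variable {E : Type*} [NormedAddCommGroup E] [NormedSpace ℝ E]
  {E' : Type*} [NormedAddCommGroup E'] [NormedSpace ℝ E']

/-- The tangent lift of a map of vector spaces. -/
def tangentRep (F : E → E') (z : E × E) : E' × E' := (F z.1, fderiv ℝ F z.1 z.2)

/-- The covector lift, multiplied by `s`, of a map `F` of vector spaces with local inverse `G`. -/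
def cotangentRep (F : E → E') (G : E' → E) (s : ℝ) (z : E × (E →L[ℝ] ℝ)) : E' × (E' →L[ℝ] ℝ) :=
  (F z.1, s • (z.2 ∘L fderiv ℝ G (F z.1)))

variable {F : E → E'} {G : E' → E} {y : E}

theorem fderiv_tangentRep (hF : ContDiffAt ℝ ∞ F y) (a : E) (w : E × E) :
    fderiv ℝ (tangentRep F) (y, a) w =
      (fderiv ℝ F y w.1, fderiv ℝ (fderiv ℝ F) y w.1 a + fderiv ℝ F y w.2) := by
  have h1 : HasFDerivAt F (fderiv ℝ F y) ((y, a) : E × E).1 :=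
    (hF.differentiableAt (by simp)).hasFDerivAt
  have h2 : HasFDerivAt (fderiv ℝ F) (fderiv ℝ (fderiv ℝ F) y) ((y, a) : E × E).1 :=
    ((hF.fderiv_right (m := ∞) (by simp)).differentiableAt (by simp)).hasFDerivAt
  have h3 := (h1.comp (y, a) hasFDerivAt_fst).prodMk
    ((h2.comp (y, a) hasFDerivAt_fst).clm_apply (hasFDerivAt_snd (p := (y, a))))
  have h4 : fderiv ℝ (tangentRep F) (y, a) = _ := h3.fderiv
  rw [h4]
  refine Prod.ext rfl ?_
  simp [add_comm]

theorem hasFDerivAt_fderiv_comp (hF : ContDiffAt ℝ ∞ F y) (hG : ContDiffAt ℝ ∞ G (F y)) :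
    HasFDerivAt (fun z => fderiv ℝ G (F z)) (fderiv ℝ (fun z => fderiv ℝ G (F z)) y) y :=
  (((hG.fderiv_right (m := ∞) (by simp)).comp y hF).differentiableAt (by simp)).hasFDerivAt

theorem fderiv_cotangentRep (hF : ContDiffAt ℝ ∞ F y) (hG : ContDiffAt ℝ ∞ G (F y)) (s : ℝ)
    (p : E →L[ℝ] ℝ) (v : E × (E →L[ℝ] ℝ)) :
    fderiv ℝ (cotangentRep F G s) (y, p) v =
      (fderiv ℝ F y v.1, s • (v.2 ∘L fderiv ℝ G (F y) +
        p ∘L fderiv ℝ (fun z => fderiv ℝ G (F z)) y v.1)) := by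
  have h1 : HasFDerivAt F (fderiv ℝ F y) ((y, p) : E × (E →L[ℝ] ℝ)).1 :=
    (hF.differentiableAt (by simp)).hasFDerivAt
  have h2 : HasFDerivAt (fun z => fderiv ℝ G (F z)) (fderiv ℝ (fun z => fderiv ℝ G (F z)) y)
    ((y, p) : E × (E →L[ℝ] ℝ)).1 := hasFDerivAt_fderiv_comp hF hG
  have h3 := (h1.comp (y, p) hasFDerivAt_fst).prodMk
    (((hasFDerivAt_snd (p := (y, p))).clm_comp (h2.comp (y, p) hasFDerivAt_fst)).const_smul s)
  have h4 : fderiv ℝ (cotangentRep F G s) (y, p) = _ := h3.fderiv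
  rw [h4]
  refine Prod.ext rfl ?_
  ext c
  simp [add_comm]

theorem fderiv_comp_fderiv_of_leftInverse (hF : ContDiffAt ℝ ∞ F y)
    (hG : ContDiffAt ℝ ∞ G (F y)) (hGF : ∀ᶠ z in 𝓝 y, G (F z) = z) (a : E) :
    fderiv ℝ G (F y) (fderiv ℝ F y a) = a := by
  have h1 := (hG.differentiableAt (by simp)).hasFDerivAt.comp y
    (hF.differentiableAt (by simp)).hasFDerivAt
  have h2 : HasFDerivAt (G ∘ F) (ContinuousLinearMap.id ℝ E) y :=
    (hasFDerivAt_id y).congr_of_eventuallyEq hGF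
  exact DFunLike.congr_fun (h1.unique h2) a

theorem fderiv_fderiv_comp_apply (hF : ContDiffAt ℝ ∞ F y) (hG : ContDiffAt ℝ ∞ G (F y))
    (hGF : ∀ᶠ z in 𝓝 y, G (F z) = z) (a b : E) :
    fderiv ℝ (fun z => fderiv ℝ G (F z)) y a (fderiv ℝ F y b) =
      -fderiv ℝ G (F y) (fderiv ℝ (fderiv ℝ F) y a b) := by
  have h2 : HasFDerivAt (fderiv ℝ F) (fderiv ℝ (fderiv ℝ F) y) y :=
    ((hF.fderiv_right (m := ∞) (by simp)).differentiableAt (by simp)).hasFDerivAt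
  have h3 := (hasFDerivAt_fderiv_comp hF hG).clm_apply (h2.clm_apply (hasFDerivAt_const b y))
  have hFn : ∀ᶠ z in 𝓝 y, ContDiffAt ℝ 1 F z :=
    (hF.of_le (by exact_mod_cast le_top)).eventually (by simp)
  have hGn : ∀ᶠ z in 𝓝 y, ContDiffAt ℝ 1 G (F z) :=
    hF.continuousAt.eventually ((hG.of_le (by exact_mod_cast le_top)).eventually (by simp))
  have h4 : (fun z => fderiv ℝ G (F z) (fderiv ℝ F z b)) =ᶠ[𝓝 y] fun _ => b := by
    filter_upwards [hFn, hGn, hGF.eventually_nhds] with z hz1 hz2 hz3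
    have h1 := (hz2.differentiableAt (by simp)).hasFDerivAt.comp z
      (hz1.differentiableAt (by simp)).hasFDerivAt
    have h2 : HasFDerivAt (G ∘ F) (ContinuousLinearMap.id ℝ E) z :=
      (hasFDerivAt_id z).congr_of_eventuallyEq hz3
    exact DFunLike.congr_fun (h1.unique h2) b
  have h5 := DFunLike.congr_fun (h3.unique ((hasFDerivAt_const b y).congr_of_eventuallyEq h4)) a
  simp at h5
  exact eq_neg_of_add_eq_zero_right h5

theorem fderiv_fderiv_symm (hF : ContDiffAt ℝ ∞ F y) (a b : E) :
    fderiv ℝ (fderiv ℝ F) y a b = fderiv ℝ (fderiv ℝ F) y b a :=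
  hF.isSymmSndFDerivAt (by simpa using! ENat.LEInfty.out) a b

/-- Naturality of the Tulczyjew pairing `(x, p, ẋ, ṗ), (x, ẋ, x', ẋ') ↦ ṗ(x') + p(ẋ')`. -/
theorem tulczyjew_pairing_natural (hF : ContDiffAt ℝ ∞ F y) (hG : ContDiffAt ℝ ∞ G (F y))
    (hGF : ∀ᶠ z in 𝓝 y, G (F z) = z) (s : ℝ) (p : E →L[ℝ] ℝ) (v : E × (E →L[ℝ] ℝ)) (w : E × E) :
    (fderiv ℝ (cotangentRep F G s) (y, p) v).2 (fderiv ℝ (tangentRep F) (y, v.1) w).1 +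
      (cotangentRep F G s (y, p)).2 (fderiv ℝ (tangentRep F) (y, v.1) w).2 =
    s * (v.2 w.1 + p w.2) := by
  have h1 := fderiv_fderiv_comp_apply hF hG hGF v.1 w.1
  have h2 := fderiv_comp_fderiv_of_leftInverse hF hG hGF
  rw [fderiv_cotangentRep hF hG, fderiv_tangentRep hF]
  simp only [cotangentRep, smul_apply, add_apply,
    ContinuousLinearMap.comp_apply, smul_eq_mul, map_add, h1, h2, map_neg,
    fderiv_fderiv_symm hF w.1 v.1]
  ring

/-- Naturality of the canonical symplectic form. -/
theorem symplectic_pairing_natural (hF : ContDiffAt ℝ ∞ F y) (hG : ContDiffAt ℝ ∞ G (F y))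
    (hGF : ∀ᶠ z in 𝓝 y, G (F z) = z) (s : ℝ) (p : E →L[ℝ] ℝ) (v w : E × (E →L[ℝ] ℝ)) :
    (fderiv ℝ (cotangentRep F G s) (y, p) w).2 (fderiv ℝ (cotangentRep F G s) (y, p) v).1 -
      (fderiv ℝ (cotangentRep F G s) (y, p) v).2 (fderiv ℝ (cotangentRep F G s) (y, p) w).1 =
    s * (w.2 v.1 - v.2 w.1) := by
  have h1 := fderiv_fderiv_comp_apply hF hG hGF
  have h2 := fderiv_comp_fderiv_of_leftInverse hF hG hGF
  rw [fderiv_cotangentRep hF hG, fderiv_cotangentRep hF hG]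
  simp only [smul_apply, add_apply,
    ContinuousLinearMap.comp_apply, smul_eq_mul, h1, h2, map_neg,
    fderiv_fderiv_symm hF w.1 v.1]
  ring

end VectorSpace

section ChartRep

variable {E : Type*} [NormedAddCommGroup E] [NormedSpace ℝ E]
  {H : Type*} [TopologicalSpace H] {I : ModelWithCorners ℝ E H} [I.Boundaryless]
  {P : Type*} [TopologicalSpace P] [ChartedSpace H P] [IsManifold I ∞ P]
  {E' : Type*} [NormedAddCommGroup E'] [NormedSpace ℝ E']
  {H' : Type*} [TopologicalSpace H'] {I' : ModelWithCorners ℝ E' H'} [I'.Boundaryless]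
  {P' : Type*} [TopologicalSpace P'] [ChartedSpace H' P'] [IsManifold I' ∞ P']
  {f : P → P'} {g : P' → P} {x : P} {x' : P'}

omit [I'.Boundaryless] in
theorem contDiffAt_chartRep (hf : ContMDiff I I' ∞ f) {y : E} (hy : y ∈ (extChartAt I x).target)
    (hfy : f ((extChartAt I x).symm y) ∈ (chartAt H' x').source) :
    ContDiffAt ℝ ∞ (chartRep I I' x x' f) y := by
  have h1 : ContMDiffAt 𝓘(ℝ, E) I ∞ (extChartAt I x).symm y :=
    (contMDiffOn_extChartAt_symm x).contMDiffAt ((isOpen_extChartAt_target x).mem_nhds hy)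
  exact ((contMDiffAt_extChartAt' hfy).comp y (hf.contMDiffAt.comp y h1)).contDiffAt

omit [IsManifold I ∞ P] in
theorem eventually_mem_chart (hf : Continuous f) (hfx : f x ∈ (chartAt H' x').source) :
    ∀ᶠ y in 𝓝 (extChartAt I x x), y ∈ (extChartAt I x).target ∧
      f ((extChartAt I x).symm y) ∈ (chartAt H' x').source := by
  refine Filter.Eventually.and (extChartAt_target_mem_nhds x) ?_
  have h1 : ContinuousAt (f ∘ (extChartAt I x).symm) (extChartAt I x x) :=
    hf.continuousAt.comp (continuousAt_extChartAt_symm x)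
  refine h1.eventually ((chartAt H' x').open_source.mem_nhds ?_)
  simpa using hfx

omit [IsManifold I ∞ P] [I'.Boundaryless] [IsManifold I' ∞ P'] in
theorem chartRep_leftInverse (hf : Continuous f) (hgf : ∀ p, g (f p) = p)
    (hfx : f x ∈ (chartAt H' x').source) :
    ∀ᶠ y in 𝓝 (extChartAt I x x), chartRep I' I x' x g (chartRep I I' x x' f y) = y := by
  filter_upwards [eventually_mem_chart (I := I) hf hfx] with y hy
  have h1 : (extChartAt I' x').symm (extChartAt I' x' (f ((extChartAt I x).symm y))) =
    f ((extChartAt I x).symm y) := (extChartAt I' x').left_inv (by simpa using hy.2)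
  simp only [chartRep, Function.comp_apply]
  rw [h1, hgf, (extChartAt I x).right_inv hy.1]

omit [I'.Boundaryless] in
theorem contDiffAt_chartRep_self (hf : ContMDiff I I' ∞ f) (hfx : f x ∈ (chartAt H' x').source) :
    ContDiffAt ℝ ∞ (chartRep I I' x x' f) (extChartAt I x x) :=
  contDiffAt_chartRep hf (mem_extChartAt_target x) (by simpa using hfx)

omit [I.Boundaryless] in
theorem contDiffAt_chartRep_inverse (hg : ContMDiff I' I ∞ g) (hgf : ∀ p, g (f p) = p)
    (hfx : f x ∈ (chartAt H' x').source) :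
    ContDiffAt ℝ ∞ (chartRep I' I x' x g) (chartRep I I' x x' f (extChartAt I x x)) := by
  have h0 : chartRep I I' x x' f (extChartAt I x x) = extChartAt I' x' (f x) := by
    simp [chartRep]
  have hfx' : f x ∈ (extChartAt I' x').source := by simpa using hfx
  rw [h0]
  refine contDiffAt_chartRep hg ((extChartAt I' x').map_source hfx') ?_
  rw [(extChartAt I' x').left_inv hfx', hgf]
  exact mem_chart_source H x

theorem tangent_extChartAt_self (u : TangentBundle I P) :
    extChartAt I.tangent u u = (extChartAt I u.proj u.proj, u.2) := by
  rw [tangent_extChartAt_apply u u (mem_chart_source H _), modelDeriv_extChartAt_self]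
  rfl

theorem cotangent_extChartAt_self (α : CotangentBundle I P) :
    extChartAt (cotangentModel I) α α = (extChartAt I α.proj α.proj, α.2) := by
  rw [cotangent_extChartAt_apply α α (mem_chart_source H _)]
  have h1 := modelDeriv_extChartAt_symm_comp (I := I) (mem_chart_source H α.proj)
  rw [modelDeriv_extChartAt_self, ContinuousLinearMap.comp_id] at h1
  rw [h1, ContinuousLinearMap.comp_id]
  rfl

omit [I'.Boundaryless] in
theorem tangentMap_eventuallyEq_tangentRep (u : TangentBundle I P) (u' : TangentBundle I' P')
    (hf : ContMDiff I I' ∞ f) (hfx : f u.proj ∈ (chartAt H' u'.proj).source) :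
    (extChartAt I'.tangent u' ∘ tangentMap I I' f ∘ (extChartAt I.tangent u).symm)
      =ᶠ[𝓝 (extChartAt I u.proj u.proj, u.2)] tangentRep (chartRep I I' u.proj u'.proj f) := by
  have h1 := ((continuous_fst (X := E) (Y := E)).tendsto
    (extChartAt I u.proj u.proj, (show E from u.2))).eventually
    (eventually_mem_chart (I := I) hf.continuous hfx)
  filter_upwards [h1] with z hz
  exact extChartAt_tangentMap u u' hz.1 (hf.mdifferentiableAt (by simp)) hz.2 z.2

theorem cotangentLift_eventuallyEq_cotangentRep (α : CotangentBundle I P)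
    (α' : CotangentBundle I' P') (hf : ContMDiff I I' ∞ f) (hg : ContMDiff I' I ∞ g)
    (hgf : ∀ p, g (f p) = p) (s : ℝ) (hfx : f α.proj ∈ (chartAt H' α'.proj).source) :
    (extChartAt (cotangentModel I') α' ∘ cotangentLift I I' f g s ∘
      (extChartAt (cotangentModel I) α).symm)
      =ᶠ[𝓝 (extChartAt I α.proj α.proj, α.2)]
        cotangentRep (chartRep I I' α.proj α'.proj f) (chartRep I' I α'.proj α.proj g) s := by
  have h1 := ((continuous_fst (X := E) (Y := E →L[ℝ] ℝ)).tendsto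
    (extChartAt I α.proj α.proj, (show E →L[ℝ] ℝ from α.2))).eventually
    (eventually_mem_chart (I := I) hf.continuous hfx)
  filter_upwards [h1] with z hz
  exact extChartAt_cotangentLift α α' s hz.1 (hg.mdifferentiableAt (by simp)) hz.2 (hgf _) z.2

end ChartRep

/-- The components of a tangent vector in the preferred chart at its base point. -/
def tangentComponent {E : Type*} [NormedAddCommGroup E] [NormedSpace ℝ E]
    {H : Type*} [TopologicalSpace H] {I : ModelWithCorners ℝ E H}
    {P : Type*} [TopologicalSpace P] [ChartedSpace H P] [IsManifold I ∞ P]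
    (u : TangentBundle I P) : E := u.2

/-- The components of a covector in the preferred chart at its base point. -/
def cotangentComponent {E : Type*} [NormedAddCommGroup E] [NormedSpace ℝ E]
    {H : Type*} [TopologicalSpace H] {I : ModelWithCorners ℝ E H}
    {P : Type*} [TopologicalSpace P] [ChartedSpace H P] [IsManifold I ∞ P]
    (α : CotangentBundle I P) : E →L[ℝ] ℝ := α.2

/-- The exterior derivative of a one-form which is linear in the preferred chart. -/
theorem extDerivOneForm_apply_of_eventuallyEq {E : Type*} [NormedAddCommGroup E] [NormedSpace ℝ E]
    {H : Type*} [TopologicalSpace H] {I : ModelWithCorners ℝ E H} [I.Boundaryless]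
    {P : Type*} [TopologicalSpace P] [ChartedSpace H P] [IsManifold I ∞ P]
    {θ : ∀ x : P, TangentSpace I x →L[ℝ] ℝ} {x : P} (L : E →L[ℝ] E →L[ℝ] ℝ)
    (hL : ∀ᶠ y in 𝓝 (extChartAt I x x), (show E →L[ℝ] ℝ from θ ((extChartAt I x).symm y)) ∘L
      modelDeriv 𝓘(ℝ, E) I (extChartAt I x).symm y = L y) (v w : E) :
    (show E →L[ℝ] E →L[ℝ] ℝ from extDerivOneForm I θ x) v w = L v w - L w v := by
  let η : E → (E →L[ℝ] ℝ) := fun y => (show E →L[ℝ] ℝ from θ ((extChartAt I x).symm y)) ∘L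
    (show E →L[ℝ] E from mfderivWithin 𝓘(ℝ, E) I (extChartAt I x).symm (Set.range I) y)
  have hη : HasFDerivAt η L (extChartAt I x x) := by
    refine L.hasFDerivAt.congr_of_eventuallyEq ?_
    filter_upwards [hL] with y hy
    simp only [η]
    rw [I.range_eq_univ, mfderivWithin_univ]
    exact hy
  have hD : fderivWithin ℝ η (range I) (extChartAt I x x) = L := by
    rw [I.range_eq_univ, fderivWithin_univ, hη.fderiv]
  change (fderivWithin ℝ η (range I) (extChartAt I x x)) v w -
    (fderivWithin ℝ η (range I) (extChartAt I x x)) w v = _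
  rw [hD]

/-- The one-form `p_i dx^i` on the product of a vector space with its dual. -/
def canonicalOneForm (E : Type*) [NormedAddCommGroup E] [NormedSpace ℝ E] :
    (E × (E →L[ℝ] ℝ)) →L[ℝ] (E × (E →L[ℝ] ℝ)) →L[ℝ] ℝ :=
  ((ContinuousLinearMap.compL ℝ (E × (E →L[ℝ] ℝ)) E ℝ).flip
    (ContinuousLinearMap.fst ℝ E (E →L[ℝ] ℝ))) ∘L ContinuousLinearMap.snd ℝ E (E →L[ℝ] ℝ)

section Pairings

variable {E : Type*} [NormedAddCommGroup E] [NormedSpace ℝ E]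
  {H : Type*} [TopologicalSpace H] {I : ModelWithCorners ℝ E H} [I.Boundaryless]
  {P : Type*} [TopologicalSpace P] [ChartedSpace H P] [IsManifold I ∞ P]
  {E' : Type*} [NormedAddCommGroup E'] [NormedSpace ℝ E']
  {H' : Type*} [TopologicalSpace H'] {I' : ModelWithCorners ℝ E' H'} [I'.Boundaryless]
  {P' : Type*} [TopologicalSpace P'] [ChartedSpace H' P'] [IsManifold I' ∞ P']
  {f : P → P'} {g : P' → P}

omit [I'.Boundaryless] in
theorem modelDeriv_extChartAt_comp_tangentMap (u : TangentBundle I P) (u' : TangentBundle I' P')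
    (hf : ContMDiff I I' ∞ f) (hfx : f u.proj ∈ (chartAt H' u'.proj).source) :
    modelDeriv I.tangent 𝓘(ℝ, E' × E') (extChartAt I'.tangent u' ∘ tangentMap I I' f) u =
      fderiv ℝ (tangentRep (chartRep I I' u.proj u'.proj f))
        (extChartAt I u.proj u.proj, u.2) := by
  have hT : MDifferentiableAt I.tangent I'.tangent (tangentMap I I' f) u :=
    (hf.contMDiff_tangentMap (m := ∞) (by simp)).mdifferentiableAt (by simp)
  have hsrc : tangentMap I I' f u ∈ (chartAt (ModelProd H' E') u').source := by
    rw [← extChartAt_source I'.tangent, tangent_extChartAt_source]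
    exact hfx
  have h1 := modelDeriv_eq_fderiv_chart ((mdifferentiableAt_extChartAt hsrc).comp u hT)
  rw [tangent_extChartAt_self] at h1
  exact h1.trans (tangentMap_eventuallyEq_tangentRep u u' hf hfx).fderiv_eq

theorem extChartAt_cotangentLift_self (α : CotangentBundle I P) (α' : CotangentBundle I' P')
    (hf : ContMDiff I I' ∞ f) (hg : ContMDiff I' I ∞ g) (hgf : ∀ p, g (f p) = p) (s : ℝ)
    (hfx : f α.proj ∈ (chartAt H' α'.proj).source) :
    extChartAt (cotangentModel I') α' (cotangentLift I I' f g s α) =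
      cotangentRep (chartRep I I' α.proj α'.proj f) (chartRep I' I α'.proj α.proj g) s
        (extChartAt I α.proj α.proj, α.2) := by
  have h1 := (cotangentLift_eventuallyEq_cotangentRep α α' hf hg hgf s hfx).eq_of_nhds
  have h2 := congrArg (extChartAt (cotangentModel I') α' ∘ cotangentLift I I' f g s)
    (extChartAt_to_inv (I := cotangentModel I) α)
  have h3 := congrArg (extChartAt (cotangentModel I') α' ∘ cotangentLift I I' f g s ∘
    (extChartAt (cotangentModel I) α).symm) (cotangent_extChartAt_self α)
  exact h2.symm.trans (h3.trans h1)

omit [I'.Boundaryless] in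
theorem extChartAt_tangentMap_self (u : TangentBundle I P) (u' : TangentBundle I' P')
    (hf : ContMDiff I I' ∞ f) (hfx : f u.proj ∈ (chartAt H' u'.proj).source) :
    extChartAt I'.tangent u' (tangentMap I I' f u) =
      tangentRep (chartRep I I' u.proj u'.proj f) (extChartAt I u.proj u.proj, u.2) := by
  have h1 := (tangentMap_eventuallyEq_tangentRep u u' hf hfx).eq_of_nhds
  have h2 := congrArg (extChartAt I'.tangent u' ∘ tangentMap I I' f)
    (extChartAt_to_inv (I := I.tangent) u)
  have h3 := congrArg (extChartAt I'.tangent u' ∘ tangentMap I I' f ∘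
    (extChartAt I.tangent u).symm) (tangent_extChartAt_self u)
  exact h2.symm.trans (h3.trans h1)

theorem modelDeriv_extChartAt_comp_cotangentLift (α : CotangentBundle I P)
    (α' : CotangentBundle I' P') (hf : ContMDiff I I' ∞ f) (hg : ContMDiff I' I ∞ g)
    (hgf : ∀ p, g (f p) = p) (s : ℝ) (hfx : f α.proj ∈ (chartAt H' α'.proj).source)
    (hL : MDifferentiableAt (cotangentModel I) (cotangentModel I') (cotangentLift I I' f g s) α) :
    modelDeriv (cotangentModel I) 𝓘(ℝ, E' × (E' →L[ℝ] ℝ))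
        (extChartAt (cotangentModel I') α' ∘ cotangentLift I I' f g s) α =
      fderiv ℝ (cotangentRep (chartRep I I' α.proj α'.proj f) (chartRep I' I α'.proj α.proj g) s)
        (extChartAt I α.proj α.proj, α.2) := by
  have hsrc : cotangentLift I I' f g s α ∈
      (chartAt (ModelProd H' (E' →L[ℝ] ℝ)) α').source := by
    rw [← extChartAt_source (cotangentModel I'), cotangent_extChartAt_source]
    exact hfx
  have h1 := modelDeriv_eq_fderiv_chart ((mdifferentiableAt_extChartAt hsrc).comp α hL)
  rw [cotangent_extChartAt_self] at h1
  exact h1.trans (cotangentLift_eventuallyEq_cotangentRep α α' hf hg hgf s hfx).fderiv_eq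

theorem modelDeriv_extChartAt_comp_cotangentLift_fst (α : CotangentBundle I P)
    (α' : CotangentBundle I' P') (a' : E') (hf : ContMDiff I I' ∞ f) (hg : ContMDiff I' I ∞ g)
    (hgf : ∀ p, g (f p) = p) (s : ℝ) (hfx : f α.proj ∈ (chartAt H' α'.proj).source)
    (hL : MDifferentiableAt (cotangentModel I) (cotangentModel I') (cotangentLift I I' f g s) α)
    (v : E × (E →L[ℝ] ℝ)) :
    (modelDeriv (cotangentModel I) 𝓘(ℝ, E' × (E' →L[ℝ] ℝ))
        (extChartAt (cotangentModel I') α' ∘ cotangentLift I I' f g s) α v).1 =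
      (extChartAt I'.tangent (⟨α'.proj, a'⟩ : TangentBundle I' P')
        (tangentMap I I' f ⟨α.proj, v.1⟩)).2 := by
  have h1 := extChartAt_tangentMap_self (⟨α.proj, v.1⟩ : TangentBundle I P)
    (⟨α'.proj, a'⟩ : TangentBundle I' P') hf hfx
  rw [modelDeriv_extChartAt_comp_cotangentLift α α' hf hg hgf s hfx hL]
  refine (congrArg Prod.fst (fderiv_cotangentRep (contDiffAt_chartRep_self hf hfx)
    (contDiffAt_chartRep_inverse hg hgf hfx) s _ v)).trans ?_
  exact (congrArg Prod.snd h1).symm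

theorem tulczyjew_pairing_lift (α : CotangentBundle I P)
    (α' : CotangentBundle I' P') (a' : E') (hf : ContMDiff I I' ∞ f) (hg : ContMDiff I' I ∞ g)
    (hgf : ∀ p, g (f p) = p) (s : ℝ) (hfx : f α.proj ∈ (chartAt H' α'.proj).source)
    (hL : MDifferentiableAt (cotangentModel I) (cotangentModel I') (cotangentLift I I' f g s) α)
    (v : E × (E →L[ℝ] ℝ)) (w : E × E) :
    (modelDeriv (cotangentModel I) 𝓘(ℝ, E' × (E' →L[ℝ] ℝ))
        (extChartAt (cotangentModel I') α' ∘ cotangentLift I I' f g s) α v).2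
      (modelDeriv I.tangent 𝓘(ℝ, E' × E')
        (extChartAt I'.tangent (⟨α'.proj, a'⟩ : TangentBundle I' P') ∘ tangentMap I I' f)
        ⟨α.proj, v.1⟩ w).1 +
      (extChartAt (cotangentModel I') α' (cotangentLift I I' f g s α)).2
        (modelDeriv I.tangent 𝓘(ℝ, E' × E')
          (extChartAt I'.tangent (⟨α'.proj, a'⟩ : TangentBundle I' P') ∘ tangentMap I I' f)
          ⟨α.proj, v.1⟩ w).2 =
    s * (v.2 w.1 + (show E →L[ℝ] ℝ from α.2) w.2) := by
  rw [extChartAt_cotangentLift_self α α' hf hg hgf s hfx,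
    modelDeriv_extChartAt_comp_cotangentLift α α' hf hg hgf s hfx hL,
    modelDeriv_extChartAt_comp_tangentMap (⟨α.proj, v.1⟩ : TangentBundle I P) _ hf hfx]
  exact tulczyjew_pairing_natural (contDiffAt_chartRep_self hf hfx)
    (contDiffAt_chartRep_inverse hg hgf hfx) (chartRep_leftInverse hf.continuous hgf hfx) s _ v w

theorem symplectic_pairing_lift (α : CotangentBundle I P)
    (α' : CotangentBundle I' P') (hf : ContMDiff I I' ∞ f) (hg : ContMDiff I' I ∞ g)
    (hgf : ∀ p, g (f p) = p) (s : ℝ) (hfx : f α.proj ∈ (chartAt H' α'.proj).source)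
    (hL : MDifferentiableAt (cotangentModel I) (cotangentModel I') (cotangentLift I I' f g s) α)
    (v w : E × (E →L[ℝ] ℝ)) :
    (modelDeriv (cotangentModel I) 𝓘(ℝ, E' × (E' →L[ℝ] ℝ))
        (extChartAt (cotangentModel I') α' ∘ cotangentLift I I' f g s) α w).2
      (modelDeriv (cotangentModel I) 𝓘(ℝ, E' × (E' →L[ℝ] ℝ))
        (extChartAt (cotangentModel I') α' ∘ cotangentLift I I' f g s) α v).1 -
      (modelDeriv (cotangentModel I) 𝓘(ℝ, E' × (E' →L[ℝ] ℝ))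
        (extChartAt (cotangentModel I') α' ∘ cotangentLift I I' f g s) α v).2
      (modelDeriv (cotangentModel I) 𝓘(ℝ, E' × (E' →L[ℝ] ℝ))
        (extChartAt (cotangentModel I') α' ∘ cotangentLift I I' f g s) α w).1 =
    s * (w.2 v.1 - v.2 w.1) := by
  rw [modelDeriv_extChartAt_comp_cotangentLift α α' hf hg hgf s hfx hL]
  exact symplectic_pairing_natural (contDiffAt_chartRep_self hf hfx)
    (contDiffAt_chartRep_inverse hg hgf hfx) (chartRep_leftInverse hf.continuous hgf hfx) s _ v w

end Pairings

section TripleMaps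

variable {E : Type*} [NormedAddCommGroup E] [NormedSpace ℝ E]
  {H : Type*} [TopologicalSpace H] {I : ModelWithCorners ℝ E H} [I.Boundaryless]
  {P : Type*} [TopologicalSpace P] [ChartedSpace H P] [IsManifold I ∞ P]

theorem modelDeriv_extChartAt_symm_self (x : P) :
    modelDeriv 𝓘(ℝ, E) I (extChartAt I x).symm (extChartAt I x x) =
      ContinuousLinearMap.id ℝ E := by
  have h1 := modelDeriv_extChartAt_symm_comp (I := I) (mem_chart_source H x)
  rwa [modelDeriv_extChartAt_self, ContinuousLinearMap.comp_id] at h1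

omit [I.Boundaryless] in
theorem contMDiff_cotangentProj : ContMDiff (cotangentModel I) I ∞ (cotangentProj I (P := P)) :=
  contMDiff_proj (fun p : P => TangentSpace I p →L[ℝ] Bundle.Trivial P ℝ p)

omit [I.Boundaryless] in
theorem contMDiff_tangentProj : ContMDiff I.tangent I ∞ (tangentProj I (P := P)) :=
  contMDiff_proj (TangentSpace I)

theorem cotangentProj_comp_symm_eventuallyEq (α : CotangentBundle I P)
    {z : E × (E →L[ℝ] ℝ)} (hz : z.1 ∈ (extChartAt I α.proj).target) :
    (cotangentProj I ∘ (extChartAt (cotangentModel I) α).symm) =ᶠ[𝓝 z]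
      (extChartAt I α.proj).symm ∘ Prod.fst := by
  filter_upwards [(continuous_fst.tendsto z).eventually
    ((isOpen_extChartAt_target α.proj).mem_nhds hz)] with y hy
  exact congrArg TotalSpace.proj (cotangent_extChartAt_symm_apply α hy y.2)

theorem modelDeriv_cotangentProj (α : CotangentBundle I P) :
    modelDeriv (cotangentModel I) I (cotangentProj I) α =
      ContinuousLinearMap.fst ℝ E (E →L[ℝ] ℝ) := by
  rw [modelDeriv_eq_fderiv_chart (contMDiff_cotangentProj.mdifferentiableAt (by simp)),
    cotangent_extChartAt_self]
  have h1 : (extChartAt I (cotangentProj I α) ∘ cotangentProj I ∘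
      (extChartAt (cotangentModel I) α).symm)
      =ᶠ[𝓝 (extChartAt I α.proj α.proj, (show E →L[ℝ] ℝ from α.2))] Prod.fst := by
    filter_upwards [cotangentProj_comp_symm_eventuallyEq α
      (z := (extChartAt I α.proj α.proj, (show E →L[ℝ] ℝ from α.2))) (mem_extChartAt_target _),
      ((continuous_fst (X := E) (Y := E →L[ℝ] ℝ)).tendsto _).eventually
        (extChartAt_target_mem_nhds (I := I) α.proj)] with y hy1 hy2
    exact (congrArg (extChartAt I α.proj) hy1).trans ((extChartAt I α.proj).right_inv hy2)
  exact h1.fderiv_eq.trans fderiv_fst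

theorem tangentOfCotangentProj_eq
    (v : TangentBundle (cotangentModel I) (CotangentBundle I P)) :
    tangentOfCotangentProj I v = ⟨v.proj.proj, (show E × (E →L[ℝ] ℝ) from v.2).1⟩ :=
  TangentBundle.mk_eq_mk rfl (DFunLike.congr_fun (modelDeriv_cotangentProj v.proj) v.2)

theorem modelDeriv_cotangent_fibre (α : CotangentBundle I P) :
    modelDeriv 𝓘(ℝ, E →L[ℝ] ℝ) (cotangentModel I)
      (fun b : E →L[ℝ] ℝ => (⟨α.proj, b⟩ : CotangentBundle I P)) (cotangentComponent α) =
      ContinuousLinearMap.inr ℝ E (E →L[ℝ] ℝ) := by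
  have h1 : (fun b : E →L[ℝ] ℝ => (⟨α.proj, b⟩ : CotangentBundle I P)) =
      (extChartAt (cotangentModel I) α).symm ∘ fun b : E →L[ℝ] ℝ => (extChartAt I α.proj α.proj, b) := by
    ext1 b
    rw [Function.comp_apply, cotangent_extChartAt_symm_apply α (mem_extChartAt_target _)]
    refine CotangentBundle.mk_eq_mk (extChartAt_to_inv _).symm ?_
    have h0 : modelDeriv I 𝓘(ℝ, E) (extChartAt I α.proj)
        ((extChartAt I α.proj).symm (extChartAt I α.proj α.proj)) =
        ContinuousLinearMap.id ℝ E := by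
      rw [extChartAt_to_inv, modelDeriv_extChartAt_self]
    ext c
    exact congrArg b (DFunLike.congr_fun h0 c).symm
  have h2 : HasFDerivAt (fun b : E →L[ℝ] ℝ => (extChartAt I α.proj α.proj, b))
      (ContinuousLinearMap.inr ℝ E (E →L[ℝ] ℝ)) (cotangentComponent α) :=
    hasFDerivAt_prodMk_right _ _
  have h3 := cotangent_extChartAt_self α
  have h4 := mdifferentiableAt_extChartAt_symm (mem_extChartAt_target (I := cotangentModel I) α)
  have h5 := modelDeriv_extChartAt_symm_self (I := cotangentModel I) α
  rw [h3] at h4 h5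
  rw [h1]
  refine (modelDeriv_comp (I := 𝓘(ℝ, E →L[ℝ] ℝ)) (I' := 𝓘(ℝ, E × (E →L[ℝ] ℝ)))
    (f := fun b : E →L[ℝ] ℝ => (extChartAt I α.proj α.proj, b)) (x := cotangentComponent α)
    h4 h2.differentiableAt.mdifferentiableAt).trans ?_
  rw [modelDeriv_eq_fderiv, h2.fderiv]
  exact congrArg (fun A : (E × (E →L[ℝ] ℝ)) →L[ℝ] (E × (E →L[ℝ] ℝ)) => A ∘L ContinuousLinearMap.inr ℝ E (E →L[ℝ] ℝ)) h5

theorem modelDeriv_tangent_fibre (u : TangentBundle I P) :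
    modelDeriv 𝓘(ℝ, E) I.tangent
      (fun b : E => (⟨u.proj, b⟩ : TangentBundle I P)) (tangentComponent u) =
      ContinuousLinearMap.inr ℝ E E := by
  have h1 : (fun b : E => (⟨u.proj, b⟩ : TangentBundle I P)) =
      (extChartAt I.tangent u).symm ∘ fun b : E => (extChartAt I u.proj u.proj, b) := by
    ext1 b
    rw [Function.comp_apply, tangent_extChartAt_symm_apply u (mem_extChartAt_target _)]
    refine TangentBundle.mk_eq_mk (extChartAt_to_inv _).symm ?_
    exact (DFunLike.congr_fun (modelDeriv_extChartAt_symm_self (I := I) u.proj) b).symm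
  have h2 : HasFDerivAt (fun b : E => (extChartAt I u.proj u.proj, b))
      (ContinuousLinearMap.inr ℝ E E) (tangentComponent u) :=
    hasFDerivAt_prodMk_right _ _
  have h3 := tangent_extChartAt_self u
  have h4 := mdifferentiableAt_extChartAt_symm (mem_extChartAt_target (I := I.tangent) u)
  have h5 := modelDeriv_extChartAt_symm_self (I := I.tangent) u
  rw [h3] at h4 h5
  rw [h1]
  refine (modelDeriv_comp (I := 𝓘(ℝ, E)) (I' := 𝓘(ℝ, E × E))
    (f := fun b : E => (extChartAt I u.proj u.proj, b)) (x := tangentComponent u)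
    h4 h2.differentiableAt.mdifferentiableAt).trans ?_
  rw [modelDeriv_eq_fderiv, h2.fderiv]
  exact congrArg (fun A : (E × E) →L[ℝ] (E × E) => A ∘L ContinuousLinearMap.inr ℝ E E) h5

/-- In the chart at `α`, the Liouville form is `p_i dx^i`. -/
theorem liouvilleForm_comp_modelDeriv (α : CotangentBundle I P) {z : E × (E →L[ℝ] ℝ)}
    (hz : z.1 ∈ (extChartAt I α.proj).target) :
    (show (E × (E →L[ℝ] ℝ)) →L[ℝ] ℝ from
      liouvilleForm I ((extChartAt (cotangentModel I) α).symm z)) ∘L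
      modelDeriv 𝓘(ℝ, E × (E →L[ℝ] ℝ)) (cotangentModel I)
        (extChartAt (cotangentModel I) α).symm z =
    z.2 ∘L ContinuousLinearMap.fst ℝ E (E →L[ℝ] ℝ) := by
  have hzt : z ∈ (extChartAt (cotangentModel I) α).target := by
    have h1 := (extChartAt I α.proj).map_target hz
    rw [extChartAt_source] at h1
    rw [FiberBundle.extChartAt_target, hom_trivializationAt_baseSet]
    exact ⟨⟨hz, h1, trivial⟩, trivial⟩
  have h1 := modelDeriv_comp (x := z)
    (contMDiff_cotangentProj (I := I) (P := P) |>.mdifferentiableAt (by simp))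
    (mdifferentiableAt_extChartAt_symm hzt)
  have h2 := modelDeriv_congr (I := 𝓘(ℝ, E × (E →L[ℝ] ℝ))) (I' := I)
    (cotangentProj_comp_symm_eventuallyEq α hz)
  have h3 : modelDeriv 𝓘(ℝ, E × (E →L[ℝ] ℝ)) I ((extChartAt I α.proj).symm ∘ Prod.fst) z =
      modelDeriv 𝓘(ℝ, E) I (extChartAt I α.proj).symm z.1 ∘L
        ContinuousLinearMap.fst ℝ E (E →L[ℝ] ℝ) := by
    refine (modelDeriv_comp (I' := 𝓘(ℝ, E)) (mdifferentiableAt_extChartAt_symm hz)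
      differentiableAt_fst.mdifferentiableAt).trans ?_
    rw [modelDeriv_eq_fderiv, fderiv_fst]
  rw [h2, h3] at h1
  have h4 : (show (E × (E →L[ℝ] ℝ)) →L[ℝ] ℝ from
      liouvilleForm I ((extChartAt (cotangentModel I) α).symm z)) =
      (show E →L[ℝ] ℝ from ((extChartAt (cotangentModel I) α).symm z).2) ∘L
        modelDeriv (cotangentModel I) I (cotangentProj I)
          ((extChartAt (cotangentModel I) α).symm z) := rfl
  rw [h4, ContinuousLinearMap.comp_assoc, ← h1]
  have h5 := cotangent_extChartAt_symm_apply α hz z.2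
  rw [Prod.mk.eta] at h5
  rw [h5]
  change (z.2 ∘L modelDeriv I 𝓘(ℝ, E) _ _) ∘L _ = _
  rw [ContinuousLinearMap.comp_assoc, ← ContinuousLinearMap.comp_assoc (modelDeriv I 𝓘(ℝ, E) _ _),
    modelDeriv_extChartAt_comp_symm hz, ContinuousLinearMap.id_comp]

theorem symplecticForm_apply (α : CotangentBundle I P) (v w : E × (E →L[ℝ] ℝ)) :
    (show (E × (E →L[ℝ] ℝ)) →L[ℝ] (E × (E →L[ℝ] ℝ)) →L[ℝ] ℝ from symplecticForm I α) v w =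
      v.2 w.1 - w.2 v.1 := by
  have hη : ∀ᶠ z in 𝓝 (extChartAt (cotangentModel I) α α),
      (show (E × (E →L[ℝ] ℝ)) →L[ℝ] ℝ from
        liouvilleForm I ((extChartAt (cotangentModel I) α).symm z)) ∘L
      modelDeriv 𝓘(ℝ, E × (E →L[ℝ] ℝ)) (cotangentModel I)
        (extChartAt (cotangentModel I) α).symm z = canonicalOneForm E z := by
    rw [cotangent_extChartAt_self]
    filter_upwards [((continuous_fst (X := E) (Y := E →L[ℝ] ℝ)).tendsto _).eventually
        (extChartAt_target_mem_nhds (I := I) α.proj)] with z hz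
    exact liouvilleForm_comp_modelDeriv α hz
  exact extDerivOneForm_apply_of_eventuallyEq (I := cotangentModel I) (canonicalOneForm E) hη v w

end TripleMaps

section LinearModels

variable (E : Type*) [NormedAddCommGroup E] [NormedSpace ℝ E]

/-- The transpose of a bilinear form minus the form. -/
def flipSub {E : Type*} [NormedAddCommGroup E] [NormedSpace ℝ E] (L : E →L[ℝ] E →L[ℝ] ℝ) :
    E →L[ℝ] E →L[ℝ] ℝ := L.flip - L

/-- The linear map `v ↦ ω(·, v)` of the canonical symplectic form on `E × E*`. -/
def symplecticDual : (E × (E →L[ℝ] ℝ)) →L[ℝ] (E × (E →L[ℝ] ℝ)) →L[ℝ] ℝ :=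
  flipSub (canonicalOneForm E)

variable {E}

theorem symplecticDual_apply (v w : E × (E →L[ℝ] ℝ)) :
    symplecticDual E v w = w.2 v.1 - v.2 w.1 := rfl

theorem symplecticDual_injective : Function.Injective (symplecticDual E) := by
  refine (injective_iff_map_eq_zero (symplecticDual E)).2 fun v hv => ?_
  refine Prod.ext ?_ ?_
  · by_contra hne
    obtain ⟨b, hb⟩ := SeparatingDual.exists_ne_zero (R := ℝ) hne
    have h1 := DFunLike.congr_fun hv (0, b)
    rw [symplecticDual_apply] at h1
    simp at h1
    exact hb h1
  · ext a
    have h1 := DFunLike.congr_fun hv (a, 0)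
    rw [symplecticDual_apply] at h1
    simpa using h1

theorem finrank_continuousDual (V : Type*) [NormedAddCommGroup V] [NormedSpace ℝ V]
    [FiniteDimensional ℝ V] : finrank ℝ (V →L[ℝ] ℝ) = finrank ℝ V :=
  (LinearMap.toContinuousLinearMap (𝕜 := ℝ) (E := V) (F' := ℝ)).finrank_eq.symm.trans
    Subspace.dual_finrank_eq

/-- A nondegenerate bilinear form on a finite-dimensional space as an isomorphism to the dual. -/
def dualEquivOfInjective {V : Type*} [NormedAddCommGroup V] [NormedSpace ℝ V]
    [FiniteDimensional ℝ V] (J : V →L[ℝ] V →L[ℝ] ℝ) (hJ : Function.Injective J) :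
    V ≃L[ℝ] (V →L[ℝ] ℝ) :=
  (LinearEquiv.ofInjectiveOfFinrankEq J.toLinearMap hJ
    (finrank_continuousDual V).symm).toContinuousLinearEquiv

variable (E) in
/-- The isomorphism `v ↦ ω(·, v)` of the canonical symplectic form on `E × E*`. -/
def symplecticDualEquiv [FiniteDimensional ℝ E] :
    (E × (E →L[ℝ] ℝ)) ≃L[ℝ] ((E × (E →L[ℝ] ℝ)) →L[ℝ] ℝ) :=
  dualEquivOfInjective (symplecticDual E) symplecticDual_injective

variable (E) in
/-- The Tulczyjew isomorphism `(x, p, ẋ, ṗ) ↦ (x, ẋ, ṗ, p)` in coordinates. -/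
def tulczyjewModel :
    ((E × (E →L[ℝ] ℝ)) × (E × (E →L[ℝ] ℝ))) ≃L[ℝ] ((E × E) × ((E × E) →L[ℝ] ℝ)) :=
  (ContinuousLinearEquiv.prodProdProdComm ℝ E (E →L[ℝ] ℝ) E (E →L[ℝ] ℝ)).trans
    ((ContinuousLinearEquiv.refl ℝ (E × E)).prodCongr
      ((ContinuousLinearEquiv.prodComm ℝ (E →L[ℝ] ℝ) (E →L[ℝ] ℝ)).trans
        (ContinuousLinearMap.coprodEquivL ℝ)))

end LinearModels

section LinearInCharts

variable {E : Type*} [NormedAddCommGroup E] [NormedSpace ℝ E]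
  {H : Type*} [TopologicalSpace H] {I : ModelWithCorners ℝ E H} [I.Boundaryless]
  {P : Type*} [TopologicalSpace P] [ChartedSpace H P] [IsManifold I ∞ P]
  {E' : Type*} [NormedAddCommGroup E'] [NormedSpace ℝ E']
  {H' : Type*} [TopologicalSpace H'] {I' : ModelWithCorners ℝ E' H'} [I'.Boundaryless]
  {P' : Type*} [TopologicalSpace P'] [ChartedSpace H' P'] [IsManifold I' ∞ P']
  {f : P → P'}

omit [I.Boundaryless] [IsManifold I ∞ P] in
theorem contMDiff_of_extChartAt_eq {K : E → E'} (hK : ContDiff ℝ ∞ K)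
    (hsrc : ∀ x, ∀ y ∈ (extChartAt I x).source, f y ∈ (extChartAt I' (f x)).source)
    (hf : ∀ x, ∀ y ∈ (extChartAt I x).source,
      extChartAt I' (f x) (f y) = K (extChartAt I x y)) : ContMDiff I I' ∞ f := by
  intro x
  have hx := mem_extChartAt_source (I := I) x
  have h1 : f =ᶠ[𝓝 x] (extChartAt I' (f x)).symm ∘ K ∘ extChartAt I x := by
    filter_upwards [extChartAt_source_mem_nhds (I := I) x] with y hy
    rw [Function.comp_apply, Function.comp_apply, ← hf x y hy,
      (extChartAt I' (f x)).left_inv (hsrc x y hy)]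
  refine ContMDiffAt.congr_of_eventuallyEq ?_ h1
  have h2 : K (extChartAt I x x) ∈ (extChartAt I' (f x)).target := by
    rw [← hf x x hx]
    exact mem_extChartAt_target _
  have h3 := (contMDiffOn_extChartAt_symm (I := I') (n := ∞) (f x)).contMDiffAt
    ((isOpen_extChartAt_target (f x)).mem_nhds h2)
  exact h3.comp x (hK.contMDiff.contMDiffAt.comp x contMDiffAt_extChartAt)

/-- A bijection which is a linear isomorphism in the preferred charts is a diffeomorphism. -/
theorem contMDiff_and_symm_of_extChartAt_eq (f : P ≃ P') (K : E ≃L[ℝ] E')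
    (hsrc : ∀ x y, y ∈ (extChartAt I x).source ↔ f y ∈ (extChartAt I' (f x)).source)
    (hf : ∀ x, ∀ y ∈ (extChartAt I x).source,
      extChartAt I' (f x) (f y) = K (extChartAt I x y)) :
    ContMDiff I I' ∞ f ∧ ContMDiff I' I ∞ f.symm := by
  refine ⟨contMDiff_of_extChartAt_eq K.contDiff (fun x y => (hsrc x y).1) hf,
    contMDiff_of_extChartAt_eq K.symm.contDiff (fun x y hy => ?_) fun x y hy => ?_⟩
  · rw [hsrc, f.apply_symm_apply, f.apply_symm_apply]
    exact hy
  · have h1 := hf (f.symm x) (f.symm y)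
      (by rw [hsrc, f.apply_symm_apply, f.apply_symm_apply]; exact hy)
    rw [f.apply_symm_apply, f.apply_symm_apply] at h1
    rw [h1, K.symm_apply_apply]

omit [I.Boundaryless] [IsManifold I ∞ P] in
theorem modelDeriv_extChartAt_comp_self {x : P} (hf : MDifferentiableAt I I' f x) :
    modelDeriv I 𝓘(ℝ, E') (extChartAt I' (f x) ∘ f) x = modelDeriv I I' f x := by
  rw [modelDeriv_comp (mdifferentiableAt_extChartAt (mem_chart_source H' _)) hf,
    modelDeriv_extChartAt_self, ContinuousLinearMap.id_comp]

omit [I.Boundaryless] [IsManifold I ∞ P] in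
theorem IsSmoothAction.modelDeriv_act_comp {h : ℝˣ → P → P} (hh : IsSmoothAction I h) (s : ℝˣ)
    (p : P) : modelDeriv I I (h s) p ∘L modelDeriv I I (h s⁻¹) (h s p) =
      ContinuousLinearMap.id ℝ E := by
  have h1 := modelDeriv_comp_eq_id (x := h s p)
    ((hh.contMDiff_act s).mdifferentiableAt (x := h s⁻¹ (h s p)) (by simp))
    ((hh.contMDiff_act s⁻¹).mdifferentiableAt (by simp))
    (Eventually.of_forall fun y => hh.act_act_inv s y)
  rwa [hh.act_inv_act] at h1

end LinearInCharts

section Formulas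

variable {E : Type*} [NormedAddCommGroup E] [NormedSpace ℝ E] [FiniteDimensional ℝ E]
  {H : Type*} [TopologicalSpace H] {I : ModelWithCorners ℝ E H} [I.Boundaryless]
  {P : Type*} [TopologicalSpace P] [ChartedSpace H P] [IsManifold I ∞ P]

/-- The covector `(w ↦ b w.1 + p w.2)` at `(x, a)`. -/
def tulczyjewCovector (α : CotangentBundle I P) (v : E × (E →L[ℝ] ℝ)) :
    CotangentBundle I.tangent (TangentBundle I P) :=
  ⟨⟨α.proj, v.1⟩, v.2.coprod (cotangentComponent α)⟩

theorem alphaMap_mk (α : CotangentBundle I P) (v : E × (E →L[ℝ] ℝ)) :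
    alphaMap I ⟨α, v⟩ = tulczyjewCovector α v :=
  CotangentBundle.mk_eq_mk (I := I.tangent) (tangentOfCotangentProj_eq _)
    (ContinuousLinearMap.ext fun _ => rfl)

omit [FiniteDimensional ℝ E] in
theorem betaMap_mk (α : CotangentBundle I P) (v : E × (E →L[ℝ] ℝ)) :
    betaMap I ⟨α, v⟩ = ⟨α, symplecticDual E v⟩ :=
  CotangentBundle.mk_eq_mk (I := cotangentModel I) rfl
    (ContinuousLinearMap.ext fun w => symplecticForm_apply α w v)

theorem cotangentCotangentToTangent_mk (α : CotangentBundle I P) (v : E × (E →L[ℝ] ℝ)) :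
    cotangentCotangentToTangent I ⟨α, symplecticDual E v⟩ = ⟨α.proj, v.1⟩ := by
  refine TangentBundle.mk_eq_mk rfl ?_
  refine (LinearEquiv.symm_apply_eq _).2 ?_
  ext b
  have h1 := DFunLike.congr_fun (modelDeriv_cotangent_fibre α) (LinearMap.toContinuousLinearMap b)
  refine (congrArg (symplecticDual E v) h1).trans ?_
  rw [symplecticDual_apply]
  simp

omit [FiniteDimensional ℝ E] in
theorem cotangentTangentToCotangent_tulczyjewCovector (α : CotangentBundle I P)
    (v : E × (E →L[ℝ] ℝ)) : cotangentTangentToCotangent I (tulczyjewCovector α v) = α := by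
  refine CotangentBundle.mk_eq_mk (q := α.proj) (b := cotangentComponent α) rfl ?_
  ext b
  have h1 := DFunLike.congr_fun (modelDeriv_tangent_fibre (⟨α.proj, v.1⟩ : TangentBundle I P)) b
  refine (congrArg (v.2.coprod (cotangentComponent α)) h1).trans ?_
  rw [ContinuousLinearMap.coprod_apply]
  change v.2 0 + cotangentComponent α b = _
  rw [map_zero, zero_add]
  rfl

variable (I P) in
/-- The Tulczyjew isomorphism as a bijection. -/
def alphaEquiv : TangentBundle (cotangentModel I) (CotangentBundle I P) ≃
    CotangentBundle I.tangent (TangentBundle I P) where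
  toFun := alphaMap I
  invFun φ := ⟨⟨φ.proj.proj, cotangentComponent φ ∘L ContinuousLinearMap.inr ℝ E E⟩,
    (tangentComponent φ.proj, cotangentComponent φ ∘L ContinuousLinearMap.inl ℝ E E)⟩
  left_inv v := by
    refine (congrArg (fun φ : CotangentBundle I.tangent (TangentBundle I P) =>
      (⟨⟨φ.proj.proj, cotangentComponent φ ∘L ContinuousLinearMap.inr ℝ E E⟩,
        (tangentComponent φ.proj, cotangentComponent φ ∘L ContinuousLinearMap.inl ℝ E E)⟩ :
        TangentBundle (cotangentModel I) (CotangentBundle I P)))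
      (alphaMap_mk v.proj (tangentComponent v))).trans ?_
    let p : E →L[ℝ] ℝ := cotangentComponent v.proj
    let w : E × (E →L[ℝ] ℝ) := tangentComponent v
    have h1 : (w.2.coprod p) ∘L ContinuousLinearMap.inr ℝ E E = p :=
      ContinuousLinearMap.coprod_comp_inr _ _
    have h2 : (w.2.coprod p) ∘L ContinuousLinearMap.inl ℝ E E = w.2 :=
      ContinuousLinearMap.coprod_comp_inl _ _
    exact TangentBundle.mk_eq_mk (I := cotangentModel I) (a := (w.1, _)) (b := w)
      (CotangentBundle.mk_eq_mk (I := I) (p := v.proj.proj) rfl h1) (Prod.ext rfl h2)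
  right_inv φ := by
    refine (alphaMap_mk _ _).trans ?_
    refine CotangentBundle.mk_eq_mk (I := I.tangent) rfl ?_
    refine (ContinuousLinearMap.comp_coprod _ _ _).symm.trans ?_
    rw [ContinuousLinearMap.coprod_inl_inr]
    exact ContinuousLinearMap.comp_id (cotangentComponent φ)

variable (I P) in
/-- The map `v ↦ ω(·, v)` as a bijection. -/
def betaEquiv : TangentBundle (cotangentModel I) (CotangentBundle I P) ≃
    CotangentBundle (cotangentModel I) (CotangentBundle I P) where
  toFun := betaMap I
  invFun φ := ⟨φ.proj, (symplecticDualEquiv E).symm (cotangentComponent φ)⟩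
  left_inv v := by
    refine (congrArg (fun φ : CotangentBundle (cotangentModel I) (CotangentBundle I P) =>
      (⟨φ.proj, (symplecticDualEquiv E).symm (cotangentComponent φ)⟩ :
        TangentBundle (cotangentModel I) (CotangentBundle I P)))
      (betaMap_mk v.proj (tangentComponent v))).trans ?_
    exact TangentBundle.mk_eq_mk (I := cotangentModel I) rfl
      ((symplecticDualEquiv E).symm_apply_apply (tangentComponent v))
  right_inv φ := (betaMap_mk _ _).trans
    (CotangentBundle.mk_eq_mk (I := cotangentModel I) rfl
      ((symplecticDualEquiv E).apply_symm_apply (cotangentComponent φ)))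

theorem cotangentCotangentToTangent_betaMap
    (v : TangentBundle (cotangentModel I) (CotangentBundle I P)) :
    cotangentCotangentToTangent I (betaMap I v) = tangentOfCotangentProj I v := by
  refine (congrArg (cotangentCotangentToTangent I)
    (betaMap_mk v.proj (tangentComponent v))).trans ?_
  exact (cotangentCotangentToTangent_mk v.proj (tangentComponent v)).trans
    (tangentOfCotangentProj_eq v).symm

theorem cotangentTangentToCotangent_alphaMap
    (v : TangentBundle (cotangentModel I) (CotangentBundle I P)) :
    cotangentTangentToCotangent I (alphaMap I v) = tangentProj (cotangentModel I) v :=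
  (congrArg (cotangentTangentToCotangent I) (alphaMap_mk v.proj (tangentComponent v))).trans
    (cotangentTangentToCotangent_tulczyjewCovector v.proj (tangentComponent v))

end Formulas

section Naturality

variable {E : Type*} [NormedAddCommGroup E] [NormedSpace ℝ E]
  {H : Type*} [TopologicalSpace H] {I : ModelWithCorners ℝ E H} [I.Boundaryless]
  {P : Type*} [TopologicalSpace P] [ChartedSpace H P] [IsManifold I ∞ P]

omit [I.Boundaryless] in
theorem cotangentLift_id : cotangentLift I I (id : P → P) id 1 = id := by
  ext1 α
  refine CotangentBundle.mk_eq_mk (q := α.proj) (b := cotangentComponent α) rfl ?_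
  rw [modelDeriv_id, one_smul]
  exact ContinuousLinearMap.comp_id _

omit [I.Boundaryless] in
theorem mdifferentiableAt_cotangentLift_id (α : CotangentBundle I P) :
    MDifferentiableAt (cotangentModel I) (cotangentModel I)
      (cotangentLift I I (id : P → P) id 1) α := by
  rw [cotangentLift_id]
  exact mdifferentiableAt_id

theorem tulczyjew_pairing_chart (α₀ α : CotangentBundle I P) (a₀ : E)
    (hα : α.proj ∈ (chartAt H α₀.proj).source) (v : E × (E →L[ℝ] ℝ)) (w : E × E) :
    (modelDeriv (cotangentModel I) 𝓘(ℝ, E × (E →L[ℝ] ℝ))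
        (extChartAt (cotangentModel I) α₀) α v).2
      (modelDeriv I.tangent 𝓘(ℝ, E × E)
        (extChartAt I.tangent (⟨α₀.proj, a₀⟩ : TangentBundle I P)) ⟨α.proj, v.1⟩ w).1 +
      (extChartAt (cotangentModel I) α₀ α).2
        (modelDeriv I.tangent 𝓘(ℝ, E × E)
          (extChartAt I.tangent (⟨α₀.proj, a₀⟩ : TangentBundle I P)) ⟨α.proj, v.1⟩ w).2 =
    v.2 w.1 + cotangentComponent α w.2 := by
  have h1 := tulczyjew_pairing_lift α α₀ a₀ (contMDiff_id (I := I)) contMDiff_id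
    (fun p => rfl) 1 hα (mdifferentiableAt_cotangentLift_id α) v w
  rw [cotangentLift_id, tangentMap_id, one_mul] at h1
  exact h1

theorem modelDeriv_cotangent_extChartAt_fst (α₀ α : CotangentBundle I P) (a₀ : E)
    (hα : α.proj ∈ (chartAt H α₀.proj).source) (v : E × (E →L[ℝ] ℝ)) :
    (modelDeriv (cotangentModel I) 𝓘(ℝ, E × (E →L[ℝ] ℝ))
        (extChartAt (cotangentModel I) α₀) α v).1 =
      (extChartAt I.tangent (⟨α₀.proj, a₀⟩ : TangentBundle I P) ⟨α.proj, v.1⟩).2 := by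
  have h1 := modelDeriv_extChartAt_comp_cotangentLift_fst α α₀ a₀ (contMDiff_id (I := I))
    contMDiff_id (fun p => rfl) 1 hα (mdifferentiableAt_cotangentLift_id α) v
  rw [cotangentLift_id, tangentMap_id] at h1
  exact h1

theorem symplectic_pairing_chart (α₀ α : CotangentBundle I P)
    (hα : α.proj ∈ (chartAt H α₀.proj).source) (v w : E × (E →L[ℝ] ℝ)) :
    symplecticDual E (modelDeriv (cotangentModel I) 𝓘(ℝ, E × (E →L[ℝ] ℝ))
        (extChartAt (cotangentModel I) α₀) α v)
      (modelDeriv (cotangentModel I) 𝓘(ℝ, E × (E →L[ℝ] ℝ))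
        (extChartAt (cotangentModel I) α₀) α w) = symplecticDual E v w := by
  have h1 := symplectic_pairing_lift α α₀ (contMDiff_id (I := I)) contMDiff_id
    (fun p => rfl) 1 hα (mdifferentiableAt_cotangentLift_id α) v w
  rw [cotangentLift_id, one_mul] at h1
  exact h1

variable {h : ℝˣ → P → P}

theorem tulczyjew_pairing_phaseLift (hh : IsSmoothAction I h) (s : ℝˣ)
    (α : CotangentBundle I P) (v : E × (E →L[ℝ] ℝ)) (w : E × E) :
    (modelDeriv (cotangentModel I) (cotangentModel I) (phaseLift I h s) α v).2
        (modelDeriv I.tangent I.tangent (tangentLift I h s) ⟨α.proj, v.1⟩ w).1 +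
      cotangentComponent (phaseLift I h s α)
        (modelDeriv I.tangent I.tangent (tangentLift I h s) ⟨α.proj, v.1⟩ w).2 =
    s * (v.2 w.1 + cotangentComponent α w.2) := by
  have hL := (hh.phaseLift.contMDiff_act s).mdifferentiableAt (x := α) (by simp)
  have hT := (hh.tangentLift.contMDiff_act s).mdifferentiableAt
    (x := (⟨α.proj, v.1⟩ : TangentBundle I P)) (by simp)
  let a : E := tangentComponent (tangentLift I h s ⟨α.proj, v.1⟩)
  have h1 := tulczyjew_pairing_lift α (phaseLift I h s α) a (hh.contMDiff_act s)
    (hh.contMDiff_act s⁻¹) (hh.act_inv_act s) s (mem_chart_source H _) hL v w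
  have h2 : modelDeriv (cotangentModel I) 𝓘(ℝ, E × (E →L[ℝ] ℝ))
      (extChartAt (cotangentModel I) (phaseLift I h s α) ∘
        cotangentLift I I (h s) (h s⁻¹) s) α =
      modelDeriv (cotangentModel I) (cotangentModel I) (phaseLift I h s) α :=
    modelDeriv_extChartAt_comp_self hL
  let u' : TangentBundle I P := ⟨(phaseLift I h s α).proj, a⟩
  have hu : tangentLift I h s ⟨α.proj, v.1⟩ = u' := rfl
  have h3 : modelDeriv I.tangent 𝓘(ℝ, E × E) (extChartAt I.tangent u' ∘ tangentLift I h s)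
      ⟨α.proj, v.1⟩ = modelDeriv I.tangent I.tangent (tangentLift I h s) ⟨α.proj, v.1⟩ := by
    rw [← hu]
    exact modelDeriv_extChartAt_comp_self hT
  have h4 : (extChartAt (cotangentModel I) (phaseLift I h s α)
      (cotangentLift I I (h s) (h s⁻¹) s α)).2 = cotangentComponent (phaseLift I h s α) :=
    congrArg Prod.snd (cotangent_extChartAt_self (phaseLift I h s α))
  have key : ∀ {X X' : (E × (E →L[ℝ] ℝ)) →L[ℝ] (E × (E →L[ℝ] ℝ))} {Y Y' : (E × E) →L[ℝ] (E × E)}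
      {c c' : E →L[ℝ] ℝ} {r : ℝ}, X = X' → Y = Y' → c = c' →
      (X v).2 (Y w).1 + c (Y w).2 = r → (X' v).2 (Y' w).1 + c' (Y' w).2 = r := by
    rintro X _ Y _ c _ r rfl rfl rfl hr
    exact hr
  exact key h2 h3 h4 h1

theorem symplectic_pairing_phaseLift (hh : IsSmoothAction I h) (s : ℝˣ)
    (α : CotangentBundle I P) (v w : E × (E →L[ℝ] ℝ)) :
    symplecticDual E (modelDeriv (cotangentModel I) (cotangentModel I) (phaseLift I h s) α v)
      (modelDeriv (cotangentModel I) (cotangentModel I) (phaseLift I h s) α w) =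
    s * symplecticDual E v w := by
  have hL := (hh.phaseLift.contMDiff_act s).mdifferentiableAt (x := α) (by simp)
  have h1 := symplectic_pairing_lift α (phaseLift I h s α) (hh.contMDiff_act s)
    (hh.contMDiff_act s⁻¹) (hh.act_inv_act s) s (mem_chart_source H _) hL v w
  have h2 : modelDeriv (cotangentModel I) 𝓘(ℝ, E × (E →L[ℝ] ℝ))
    (extChartAt (cotangentModel I) (phaseLift I h s α) ∘
      cotangentLift I I (h s) (h s⁻¹) s) α = _ := modelDeriv_extChartAt_comp_self hL
  rw [h2] at h1
  exact h1

theorem tangentOfCotangentProj_tangentLift (hh : IsSmoothAction I h) (s : ℝˣ)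
    (v : TangentBundle (cotangentModel I) (CotangentBundle I P)) :
    tangentOfCotangentProj I (tangentLift (cotangentModel I) (phaseLift I h) s v) =
      tangentLift I h s (tangentOfCotangentProj I v) := by
  have hp : ∀ α : CotangentBundle I P,
      MDifferentiableAt (cotangentModel I) I (cotangentProj I) α :=
    fun α => contMDiff_cotangentProj.mdifferentiableAt (by simp)
  have h1 := tangentMap_comp_at (I := cotangentModel I) (I' := cotangentModel I) (I'' := I)
    (f := phaseLift I h s) (g := cotangentProj I) v (hp _)
    ((hh.phaseLift.contMDiff_act s).mdifferentiableAt (by simp))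
  have h2 := tangentMap_comp_at (I := cotangentModel I) (I' := I) (I'' := I)
    (f := cotangentProj I) (g := h s) v
    ((hh.contMDiff_act s).mdifferentiableAt (by simp)) (hp _)
  exact h1.symm.trans h2

theorem modelDeriv_phaseLift_fst (hh : IsSmoothAction I h) (s : ℝˣ) (α : CotangentBundle I P)
    (v : E × (E →L[ℝ] ℝ)) :
    (⟨h s α.proj, (modelDeriv (cotangentModel I) (cotangentModel I) (phaseLift I h s) α v).1⟩ :
      TangentBundle I P) = tangentLift I h s ⟨α.proj, v.1⟩ := by
  have h1 := tangentOfCotangentProj_tangentLift hh s ⟨α, v⟩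
  rw [tangentOfCotangentProj_eq, tangentOfCotangentProj_eq] at h1
  exact h1

end Naturality

section Smoothness

variable {E : Type*} [NormedAddCommGroup E] [NormedSpace ℝ E] [FiniteDimensional ℝ E]
  {H : Type*} [TopologicalSpace H] {I : ModelWithCorners ℝ E H} [I.Boundaryless]
  {P : Type*} [TopologicalSpace P] [ChartedSpace H P] [IsManifold I ∞ P]

/-- The expression of a covector in a chart is determined by its values on the images of vectors. -/
theorem cotangent_extChartAt_apply_eq {E : Type*} [NormedAddCommGroup E] [NormedSpace ℝ E]
    {H : Type*} [TopologicalSpace H] {I : ModelWithCorners ℝ E H} [I.Boundaryless]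
    {P : Type*} [TopologicalSpace P] [ChartedSpace H P] [IsManifold I ∞ P]
    (x₀ x : P) (hx : x ∈ (chartAt H x₀).source) (φ₀ φ ψ : E →L[ℝ] ℝ)
    (hψ : ∀ w, ψ (modelDeriv I 𝓘(ℝ, E) (extChartAt I x₀) x w) = φ w) :
    extChartAt (cotangentModel I) (⟨x₀, φ₀⟩ : CotangentBundle I P) ⟨x, φ⟩ =
      (extChartAt I x₀ x, ψ) := by
  have hx' : x ∈ (extChartAt I x₀).source := by simpa using hx
  refine (cotangent_extChartAt_apply (⟨x₀, φ₀⟩ : CotangentBundle I P) ⟨x, φ⟩ hx).trans ?_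
  refine Prod.ext rfl ?_
  have h1 := modelDeriv_extChartAt_comp_symm ((extChartAt I x₀).map_source hx')
  rw [(extChartAt I x₀).left_inv hx'] at h1
  ext w
  exact (hψ _).symm.trans (congrArg ψ (DFunLike.congr_fun h1 w))

theorem contMDiff_alphaEquiv :
    ContMDiff (cotangentModel I).tangent (cotangentModel I.tangent) ∞ (alphaEquiv I P) ∧
      ContMDiff (cotangentModel I.tangent) (cotangentModel I).tangent ∞ (alphaEquiv I P).symm := by
  refine contMDiff_and_symm_of_extChartAt_eq (alphaEquiv I P) (tulczyjewModel E) ?_ ?_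
  · intro v₀ v
    rw [tangent_extChartAt_source, cotangent_extChartAt_source, ← extChartAt_source (cotangentModel I),
      ← extChartAt_source I.tangent, mem_ofPred_eq, mem_ofPred_eq, tangent_extChartAt_source,
      cotangent_extChartAt_source]
    rfl
  · intro v₀ v hv
    have hv1 := hv
    rw [tangent_extChartAt_source, mem_ofPred_eq] at hv1
    have hv2 := hv1
    rw [← extChartAt_source (cotangentModel I), cotangent_extChartAt_source, mem_ofPred_eq] at hv2
    let w₀ : E × (E →L[ℝ] ℝ) := tangentComponent v₀
    let w : E × (E →L[ℝ] ℝ) := tangentComponent v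
    have hx : (⟨v.proj.proj, w.1⟩ : TangentBundle I P) ∈
        (chartAt (ModelProd H E) (⟨v₀.proj.proj, w₀.1⟩ : TangentBundle I P)).source := by
      rw [← extChartAt_source I.tangent, tangent_extChartAt_source]
      exact hv2
    let A := modelDeriv (cotangentModel I) 𝓘(ℝ, E × (E →L[ℝ] ℝ))
        (extChartAt (cotangentModel I) v₀.proj) v.proj
    have h1 := cotangent_extChartAt_apply_eq (I := I.tangent) _ _ hx
      (w₀.2.coprod (cotangentComponent v₀.proj)) (w.2.coprod (cotangentComponent v.proj))
      ((A w).2.coprod (extChartAt (cotangentModel I) v₀.proj v.proj).2)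
      (fun u => tulczyjew_pairing_chart v₀.proj v.proj w₀.1 hv2 w u)
    have h2 := congrArg₂ (fun a b => extChartAt (cotangentModel I.tangent) a b)
      (alphaMap_mk v₀.proj w₀) (alphaMap_mk v.proj w)
    refine h2.trans (h1.trans ?_)
    refine Eq.trans ?_ (congrArg (tulczyjewModel E) (tangent_extChartAt_apply v₀ v hv1)).symm
    refine Prod.ext (Prod.ext ?_ ?_) rfl
    · exact congrArg Prod.fst (tangent_extChartAt_apply (⟨v₀.proj.proj, w₀.1⟩ : TangentBundle I P)
        ⟨v.proj.proj, w.1⟩ hv2) |>.trans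
        (congrArg Prod.fst (cotangent_extChartAt_apply v₀.proj v.proj hv2)).symm
    · exact (modelDeriv_cotangent_extChartAt_fst v₀.proj v.proj w₀.1 hv2 w).symm

theorem contMDiff_betaEquiv :
    ContMDiff (cotangentModel I).tangent (cotangentModel (cotangentModel I)) ∞ (betaEquiv I P) ∧
      ContMDiff (cotangentModel (cotangentModel I)) (cotangentModel I).tangent ∞
        (betaEquiv I P).symm := by
  refine contMDiff_and_symm_of_extChartAt_eq (betaEquiv I P)
    ((ContinuousLinearEquiv.refl ℝ (E × (E →L[ℝ] ℝ))).prodCongr (symplecticDualEquiv E)) ?_ ?_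
  · intro v₀ v
    rw [tangent_extChartAt_source, cotangent_extChartAt_source]
    rfl
  · intro v₀ v hv
    have hv1 := hv
    rw [tangent_extChartAt_source, mem_ofPred_eq] at hv1
    have hv2 := hv1
    rw [← extChartAt_source (cotangentModel I), cotangent_extChartAt_source, mem_ofPred_eq] at hv2
    let w₀ : E × (E →L[ℝ] ℝ) := tangentComponent v₀
    let w : E × (E →L[ℝ] ℝ) := tangentComponent v
    let A := modelDeriv (cotangentModel I) 𝓘(ℝ, E × (E →L[ℝ] ℝ))
        (extChartAt (cotangentModel I) v₀.proj) v.proj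
    have h1 := cotangent_extChartAt_apply_eq (I := cotangentModel I) _ _ hv1
      (symplecticDual E w₀) (symplecticDual E w) (symplecticDual E (A w))
      (fun u => symplectic_pairing_chart v₀.proj v.proj hv2 w u)
    have h2 := congrArg₂ (fun a b => extChartAt (cotangentModel (cotangentModel I)) a b)
      (betaMap_mk v₀.proj w₀) (betaMap_mk v.proj w)
    refine h2.trans (h1.trans ?_)
    exact (congrArg ((ContinuousLinearEquiv.refl ℝ (E × (E →L[ℝ] ℝ))).prodCongr
      (symplecticDualEquiv E)) (tangent_extChartAt_apply v₀ v hv1)).symm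

end Smoothness

section Equivariance

variable {E : Type*} [NormedAddCommGroup E] [NormedSpace ℝ E] [FiniteDimensional ℝ E]
  {H : Type*} [TopologicalSpace H] {I : ModelWithCorners ℝ E H} [I.Boundaryless]
  {P : Type*} [TopologicalSpace P] [ChartedSpace H P] [IsManifold I ∞ P] {h : ℝˣ → P → P}

omit [FiniteDimensional ℝ E] [I.Boundaryless] [IsManifold I ∞ P] in
/-- The phase lift of a covector is determined by its values on the images of vectors. -/
theorem phaseLift_mk_eq (hh : IsSmoothAction I h) (s : ℝˣ) (x : P) (φ ψ : E →L[ℝ] ℝ)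
    (hψ : ∀ w, ψ (modelDeriv I I (h s) x w) = s * φ w) :
    phaseLift I h s ⟨x, φ⟩ = ⟨h s x, ψ⟩ := by
  refine CotangentBundle.mk_eq_mk rfl ?_
  ext w
  have h1 := DFunLike.congr_fun (hh.modelDeriv_act_comp s x) w
  exact (hψ _).symm.trans (congrArg ψ h1)

theorem alphaMap_tangentLift (hh : IsSmoothAction I h) (s : ℝˣ)
    (v : TangentBundle (cotangentModel I) (CotangentBundle I P)) :
    alphaMap I (tangentLift (cotangentModel I) (phaseLift I h) s v) =
      phaseLift I.tangent (tangentLift I h) s (alphaMap I v) := by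
  let w : E × (E →L[ℝ] ℝ) := tangentComponent v
  let A := modelDeriv (cotangentModel I) (cotangentModel I) (phaseLift I h s) v.proj
  refine (alphaMap_mk (phaseLift I h s v.proj) (A w)).trans ?_
  refine Eq.trans ?_ (congrArg (phaseLift I.tangent (tangentLift I h) s)
    (alphaMap_mk v.proj w)).symm
  refine Eq.trans ?_ (phaseLift_mk_eq hh.tangentLift s _ (w.2.coprod (cotangentComponent v.proj))
    ((A w).2.coprod (cotangentComponent (phaseLift I h s v.proj)))
    (fun u => tulczyjew_pairing_phaseLift hh s v.proj w u)).symm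
  exact CotangentBundle.mk_eq_mk (I := I.tangent) (modelDeriv_phaseLift_fst hh s v.proj w) rfl

omit [FiniteDimensional ℝ E] in
theorem betaMap_tangentLift (hh : IsSmoothAction I h) (s : ℝˣ)
    (v : TangentBundle (cotangentModel I) (CotangentBundle I P)) :
    betaMap I (tangentLift (cotangentModel I) (phaseLift I h) s v) =
      phaseLift (cotangentModel I) (phaseLift I h) s (betaMap I v) := by
  let w : E × (E →L[ℝ] ℝ) := tangentComponent v
  let A := modelDeriv (cotangentModel I) (cotangentModel I) (phaseLift I h s) v.proj
  refine (betaMap_mk (phaseLift I h s v.proj) (A w)).trans ?_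
  refine Eq.trans ?_ (congrArg (phaseLift (cotangentModel I) (phaseLift I h) s)
    (betaMap_mk v.proj w)).symm
  exact (phaseLift_mk_eq hh.phaseLift s v.proj (symplecticDual E w) (symplecticDual E (A w))
    (fun u => symplectic_pairing_phaseLift hh s v.proj w u)).symm

end Equivariance

section Projections

variable {E : Type*} [NormedAddCommGroup E] [NormedSpace ℝ E]
  {H : Type*} [TopologicalSpace H] {I : ModelWithCorners ℝ E H}
  {P : Type*} [TopologicalSpace P] [ChartedSpace H P] [IsManifold I ∞ P]

omit [IsManifold I ∞ P] in
theorem tangentProj_surjective : Function.Surjective (tangentProj I (P := P)) :=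
  fun p => ⟨⟨p, 0⟩, rfl⟩

omit [IsManifold I ∞ P] in
theorem cotangentProj_surjective : Function.Surjective (cotangentProj I (P := P)) :=
  fun p => ⟨⟨p, 0⟩, rfl⟩

theorem contMDiff_tangentOfCotangentProj : ContMDiff (cotangentModel I).tangent I.tangent ∞
    (tangentOfCotangentProj I (P := P)) :=
  contMDiff_cotangentProj.contMDiff_tangentMap (by simp)

theorem tangentOfCotangentProj_surjective [I.Boundaryless] :
    Function.Surjective (tangentOfCotangentProj I (P := P)) := by
  intro u
  refine ⟨⟨⟨u.proj, 0⟩, (tangentComponent u, 0)⟩, ?_⟩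
  exact (tangentOfCotangentProj_eq _).trans rfl

omit [IsManifold I ∞ P] in
theorem tangentProj_tangentLift (h : ℝˣ → P → P) (s : ℝˣ) (v : TangentBundle I P) :
    tangentProj I (tangentLift I h s v) = h s (tangentProj I v) := rfl

omit [IsManifold I ∞ P] in
theorem cotangentProj_phaseLift (h : ℝˣ → P → P) (s : ℝˣ) (α : CotangentBundle I P) :
    cotangentProj I (phaseLift I h s α) = h s (cotangentProj I α) := rfl

end Projections

section DualProjections

variable {E : Type*} [NormedAddCommGroup E] [NormedSpace ℝ E] [FiniteDimensional ℝ E]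
  {H : Type*} [TopologicalSpace H] {I : ModelWithCorners ℝ E H} [I.Boundaryless]
  {P : Type*} [TopologicalSpace P] [ChartedSpace H P] [IsManifold I ∞ P] {h : ℝˣ → P → P}

theorem cotangentCotangentToTangent_eq : cotangentCotangentToTangent I (P := P) =
    tangentOfCotangentProj I ∘ (betaEquiv I P).symm := by
  rw [Equiv.eq_comp_symm]
  exact funext cotangentCotangentToTangent_betaMap

theorem cotangentTangentToCotangent_eq : cotangentTangentToCotangent I (P := P) =
    tangentProj (cotangentModel I) ∘ (alphaEquiv I P).symm := by
  rw [Equiv.eq_comp_symm]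
  exact funext cotangentTangentToCotangent_alphaMap

theorem contMDiff_cotangentCotangentToTangent :
    ContMDiff (cotangentModel (cotangentModel I)) I.tangent ∞
      (cotangentCotangentToTangent I (P := P)) := by
  rw [cotangentCotangentToTangent_eq]
  exact contMDiff_tangentOfCotangentProj.comp contMDiff_betaEquiv.2

theorem contMDiff_cotangentTangentToCotangent :
    ContMDiff (cotangentModel I.tangent) (cotangentModel I) ∞
      (cotangentTangentToCotangent I (P := P)) := by
  rw [cotangentTangentToCotangent_eq]
  exact contMDiff_tangentProj.comp contMDiff_alphaEquiv.2

theorem cotangentCotangentToTangent_surjective :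
    Function.Surjective (cotangentCotangentToTangent I (P := P)) := by
  rw [cotangentCotangentToTangent_eq]
  exact tangentOfCotangentProj_surjective.comp (betaEquiv I P).symm.surjective

theorem cotangentTangentToCotangent_surjective :
    Function.Surjective (cotangentTangentToCotangent I (P := P)) := by
  rw [cotangentTangentToCotangent_eq]
  exact tangentProj_surjective.comp (alphaEquiv I P).symm.surjective

theorem cotangentCotangentToTangent_phaseLift (hh : IsSmoothAction I h) (s : ℝˣ)
    (φ : CotangentBundle (cotangentModel I) (CotangentBundle I P)) :
    cotangentCotangentToTangent I (phaseLift (cotangentModel I) (phaseLift I h) s φ) =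
      tangentLift I h s (cotangentCotangentToTangent I φ) := by
  obtain ⟨v, rfl⟩ := (betaEquiv I P).surjective φ
  refine (congrArg (cotangentCotangentToTangent I) (betaMap_tangentLift hh s v).symm).trans ?_
  refine (cotangentCotangentToTangent_betaMap _).trans
    ((tangentOfCotangentProj_tangentLift hh s v).trans ?_)
  exact congrArg (tangentLift I h s) (cotangentCotangentToTangent_betaMap v).symm

theorem cotangentTangentToCotangent_phaseLift (hh : IsSmoothAction I h) (s : ℝˣ)
    (φ : CotangentBundle I.tangent (TangentBundle I P)) :
    cotangentTangentToCotangent I (phaseLift I.tangent (tangentLift I h) s φ) =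
      phaseLift I h s (cotangentTangentToCotangent I φ) := by
  obtain ⟨v, rfl⟩ := (alphaEquiv I P).surjective φ
  refine (congrArg (cotangentTangentToCotangent I) (alphaMap_tangentLift hh s v).symm).trans ?_
  refine (cotangentTangentToCotangent_alphaMap _).trans ?_
  exact congrArg (phaseLift I h s) (cotangentTangentToCotangent_alphaMap v).symm

end DualProjections

namespace RtPrincipalBundle

variable {E : Type*} [NormedAddCommGroup E] [NormedSpace ℝ E] [FiniteDimensional ℝ E]
  {H : Type*} [TopologicalSpace H] {I : ModelWithCorners ℝ E H} [I.Boundaryless]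
  {P : Type*} [TopologicalSpace P] [ChartedSpace H P] [IsManifold I ∞ P] {h : ℝˣ → P → P}
  (B : RtPrincipalBundle I h)

include B

theorem nonempty_tangentLift : Nonempty (RtPrincipalBundle I.tangent (tangentLift I h)) := by
  have := B.t2Space
  have := B.secondCountableTopology
  have := FiniteDimensional.proper ℝ E
  have : T2Space (TangentBundle I P) := t2Space_totalSpace E (TangentSpace I)
  have : SecondCountableTopology (TangentBundle I P) :=
    secondCountableTopology_totalSpace E (TangentSpace I)
  exact B.nonempty_of_equivariant B.isSmoothAction.tangentLift contMDiff_tangentProj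
    fun _ _ => rfl

theorem nonempty_phaseLift : Nonempty (RtPrincipalBundle (cotangentModel I) (phaseLift I h)) := by
  have := B.t2Space
  have := B.secondCountableTopology
  have := FiniteDimensional.proper ℝ E
  have : T2Space (CotangentBundle I P) := t2Space_totalSpace (E →L[ℝ] ℝ) _
  have : SecondCountableTopology (CotangentBundle I P) :=
    secondCountableTopology_totalSpace (E →L[ℝ] ℝ) _
  exact B.nonempty_of_equivariant B.isSmoothAction.phaseLift contMDiff_cotangentProj
    fun _ _ => rfl

end RtPrincipalBundle

end Tulczyjew

end

theorem theoremt1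
    {E : Type*} [NormedAddCommGroup E] [NormedSpace ℝ E] [FiniteDimensional ℝ E]
    {H : Type*} [TopologicalSpace H] (I : ModelWithCorners ℝ E H) [I.Boundaryless]
    {P : Type*} [TopologicalSpace P] [ChartedSpace H P] [IsManifold I ∞ P]
    (h : ℝˣ → P → P) (BP : Tulczyjew.RtPrincipalBundle I h) :
    ∃ (BT : Tulczyjew.RtPrincipalBundle I.tangent (Tulczyjew.tangentLift I h))
      (BC : Tulczyjew.RtPrincipalBundle (Tulczyjew.cotangentModel I) (Tulczyjew.phaseLift I h))
      (BTC : Tulczyjew.RtPrincipalBundle (Tulczyjew.cotangentModel I).tangent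
        (Tulczyjew.tangentLift (Tulczyjew.cotangentModel I) (Tulczyjew.phaseLift I h)))
      (BCC : Tulczyjew.RtPrincipalBundle
        (Tulczyjew.cotangentModel (Tulczyjew.cotangentModel I))
        (Tulczyjew.phaseLift (Tulczyjew.cotangentModel I) (Tulczyjew.phaseLift I h)))
      (BCT : Tulczyjew.RtPrincipalBundle (Tulczyjew.cotangentModel I.tangent)
        (Tulczyjew.phaseLift I.tangent (Tulczyjew.tangentLift I h))),
      -- the top row: `β_P : TT*P → T*T*P` and `α_P : TT*P → T*TP`
      Tulczyjew.IsSurjectivePrincipalMorphism BTC BCC (Tulczyjew.betaMap I) ∧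
      Tulczyjew.IsPrincipalIsomorphism BTC BCC (Tulczyjew.betaMap I) ∧
      Tulczyjew.IsSurjectivePrincipalMorphism BTC BCT (Tulczyjew.alphaMap I) ∧
      Tulczyjew.IsPrincipalIsomorphism BTC BCT (Tulczyjew.alphaMap I) ∧
      -- the projections of `T*T*P` onto `T*P` and `TP`
      Tulczyjew.IsSurjectivePrincipalMorphism BCC BC
        (Tulczyjew.cotangentProj (Tulczyjew.cotangentModel I)) ∧
      Tulczyjew.IsSurjectivePrincipalMorphism BCC BT
        (Tulczyjew.cotangentCotangentToTangent I) ∧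
      -- the projections of `TT*P` onto `T*P` and `TP`
      Tulczyjew.IsSurjectivePrincipalMorphism BTC BC
        (Tulczyjew.tangentProj (Tulczyjew.cotangentModel I)) ∧
      Tulczyjew.IsSurjectivePrincipalMorphism BTC BT (Tulczyjew.tangentOfCotangentProj I) ∧
      -- the projections of `T*TP` onto `T*P` and `TP`
      Tulczyjew.IsSurjectivePrincipalMorphism BCT BC
        (Tulczyjew.cotangentTangentToCotangent I) ∧
      Tulczyjew.IsSurjectivePrincipalMorphism BCT BT (Tulczyjew.cotangentProj I.tangent) ∧
      -- the projections `τ_P : TP → P` and `π_P : T*P → P`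
      Tulczyjew.IsSurjectivePrincipalMorphism BT BP (Tulczyjew.tangentProj I) ∧
      Tulczyjew.IsSurjectivePrincipalMorphism BC BP (Tulczyjew.cotangentProj I) ∧
      -- the remaining horizontal arrows, which are identity maps
      Tulczyjew.IsSurjectivePrincipalMorphism BT BT id ∧
      Tulczyjew.IsSurjectivePrincipalMorphism BC BC id ∧
      Tulczyjew.IsSurjectivePrincipalMorphism BP BP id := by
  have hh := BP.isSmoothAction
  obtain ⟨BT⟩ := BP.nonempty_tangentLift
  obtain ⟨BC⟩ := BP.nonempty_phaseLift
  obtain ⟨BTC⟩ := BC.nonempty_tangentLift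
  obtain ⟨BCC⟩ := BC.nonempty_phaseLift
  obtain ⟨BCT⟩ := BT.nonempty_phaseLift
  refine ⟨BT, BC, BTC, BCC, BCT, ?_, ?_, ?_, ?_, ?_, ?_, ?_, ?_, ?_, ?_, ?_, ?_, ?_, ?_, ?_⟩
  · exact BTC.isSurjectivePrincipalMorphism BCC Tulczyjew.contMDiff_betaEquiv.1 (Tulczyjew.betaMap_tangentLift hh)
      (Tulczyjew.betaEquiv I P).surjective
  · exact BTC.isPrincipalIsomorphism BCC Tulczyjew.contMDiff_betaEquiv.1 (Tulczyjew.betaMap_tangentLift hh)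
      Tulczyjew.contMDiff_betaEquiv.2 (Tulczyjew.betaEquiv I P).left_inv
      (Tulczyjew.betaEquiv I P).right_inv
  · exact BTC.isSurjectivePrincipalMorphism BCT Tulczyjew.contMDiff_alphaEquiv.1 (Tulczyjew.alphaMap_tangentLift hh)
      (Tulczyjew.alphaEquiv I P).surjective
  · exact BTC.isPrincipalIsomorphism BCT Tulczyjew.contMDiff_alphaEquiv.1 (Tulczyjew.alphaMap_tangentLift hh)
      Tulczyjew.contMDiff_alphaEquiv.2 (Tulczyjew.alphaEquiv I P).left_inv
      (Tulczyjew.alphaEquiv I P).right_inv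
  · exact BCC.isSurjectivePrincipalMorphism BC Tulczyjew.contMDiff_cotangentProj
      (Tulczyjew.cotangentProj_phaseLift _) Tulczyjew.cotangentProj_surjective
  · exact BCC.isSurjectivePrincipalMorphism BT Tulczyjew.contMDiff_cotangentCotangentToTangent
      (Tulczyjew.cotangentCotangentToTangent_phaseLift hh)
      Tulczyjew.cotangentCotangentToTangent_surjective
  · exact BTC.isSurjectivePrincipalMorphism BC Tulczyjew.contMDiff_tangentProj
      (Tulczyjew.tangentProj_tangentLift _) Tulczyjew.tangentProj_surjective
  · exact BTC.isSurjectivePrincipalMorphism BT Tulczyjew.contMDiff_tangentOfCotangentProj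
      (Tulczyjew.tangentOfCotangentProj_tangentLift hh) Tulczyjew.tangentOfCotangentProj_surjective
  · exact BCT.isSurjectivePrincipalMorphism BC Tulczyjew.contMDiff_cotangentTangentToCotangent
      (Tulczyjew.cotangentTangentToCotangent_phaseLift hh)
      Tulczyjew.cotangentTangentToCotangent_surjective
  · exact BCT.isSurjectivePrincipalMorphism BT Tulczyjew.contMDiff_cotangentProj
      (Tulczyjew.cotangentProj_phaseLift _) Tulczyjew.cotangentProj_surjective
  · exact BT.isSurjectivePrincipalMorphism BP Tulczyjew.contMDiff_tangentProj
      (Tulczyjew.tangentProj_tangentLift _) Tulczyjew.tangentProj_surjective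
  · exact BC.isSurjectivePrincipalMorphism BP Tulczyjew.contMDiff_cotangentProj
      (Tulczyjew.cotangentProj_phaseLift _) Tulczyjew.cotangentProj_surjective
  · exact BT.isSurjectivePrincipalMorphism BT contMDiff_id (fun _ _ => rfl)
      Function.surjective_id
  · exact BC.isSurjectivePrincipalMorphism BC contMDiff_id (fun _ _ => rfl)
      Function.surjective_id
  · exact BP.isSurjectivePrincipalMorphism BP contMDiff_id (fun _ _ => rfl)
      Function.surjective_id
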